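/- Consider $M$ pairs of users $(A_i,B_i)$, $1\le i\le M$, and a relay $\mathsf R$. The links from each user $u$ to the relay and from the relay to $u$ have nonnegative integer gains $n_{u\mathsf R}$ and $n_{\mathsf R u}$; there are no other links (all other gains are $0$). Let $q$ be the largest gain. In each time slot every node $k$ sends $x_k\in\mathbb F_2^q$ and every node $j$ receives $y_j=\sum_k S^{\,q-n_{kj}}x_k$, where $S$ is the $q\times q$ shift matrix over $\mathbb F_2$. $A_i$ and $B_i$ want to exchange messages through the relay; $R_u\ge 0$ denotes the rate, in bits per slot, from user $u$ to its partner. Inputs may depend causally on what the node has received. A full-duplex relay listens and transmits in every slot. A half-duplex relay only listens or only transmits in a given slot, by a schedule fixed in advance in which it listens a fixed fraction $t\in[0,1]$ of the slots (up to rounding to an integer number of slots) and transmits in the others. The capacity region is the set of rate tuples that can be approached by block codes of arbitrarily large length with error probability tending to $0$. The cut-set upper bound region is the set of $R\ge 0$ for which there are joint distributions of the inputs $(x_k)_k$, one for each relay mode, such that for every set $\Omega$ of nodes the total rate from users in $\Omega$ to partners in $\Omega^c$ is at most $I(X_\Omega;Y_{\Omega^c}\mid X_{\Omega^c})$ (full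 duplex), respectively $t\,I_{\rm listen}(X_\Omega;Y_{\Omega^c}\mid X_{\Omega^c})+(1-t)\,I_{\rm transmit}(X_\Omega;Y_{\Omega^c}\mid X_{\Omega^c})$ (half duplex). An equation forwarding scheme with period $Q$ is a block code in which messages are bit strings; each bit is sent uncoded on exactly one level of one slot; bits of different pairs never meet on the same received level of the relay; the relay only re-orders the received levels (equations) and forwards each at most once, within the same or the next period of $Q$ slots; and each user obtains each bit of its partner from one received level, after adding at most one bit of its own. **Theorem.** For the full-duplex relay, and for the half-duplex relay with every fixed listen fraction $t\in[0,1]$: 1. The capacity region equals the cut-set upper bound region, and every point of it can be approached by equation forwarding schemes with zero error. 2. This region consists of all $R\ge 0$ such that for every set $I$ of pairs and every choice, for each $i\in I$, of a source $s_i\in\{A_i,B_i\}$ with partner $d_i$, $$\sum_{i\in I}R_{s_i}\le\min\Bigl(\alpha\max_{i\in I}n_{s_i\mathsf R},\ \beta\max_{i\in I}n_{\mathsf R d_i}\Bigr),$$ where $(\alpha,\beta)=(1,1)$ for full duplex and $(\alpha,\beta)=(t,1-t)$ for half duplex (a maximum over $I=\emptyset$ is $0$). 3. Full duplex: if $R$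 is in the region, $Q\ge1$ is an integer and $QR$ is integral (in particular, $Q=1$ if $R$ is integral), then for every integer $B\ge 0$ there is a zero-error equation forwarding scheme with period $Q$ and length $(B+1)Q$ that delivers exactly $BQR_u$ bits from each user $u$ to its partner. Half duplex: if moreover $Qt$ is an integer, and $R$ is in the region for $t$, then there is a zero-error equation forwarding scheme of length $Q$, with $Qt$ listen slots and $Q(1-t)$ transmit slots, that delivers exactly $QR_u$ bits from each user $u$ to its partner. -/

import Mathlib

open scoped Matrix

namespace BiRelay

/-- The `2M` users: `(i, false)` is `A_i` and `(i, true)` is `B_i`. -/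
abbrev User (M : ℕ) := Fin M × Bool

/-- `A_i` and `B_i` are partners of each other. -/
abbrev partner {M : ℕ} (u : User M) : User M := (u.1, !u.2)

/-- All nodes: `none` is the relay, `some u` is the user `u`. -/
abbrev Node (M : ℕ) := Option (User M)

/-- The `M`-pair bidirectional relay network: nonnegative integer gains of the links from the users
to the relay (`up`) and from the relay to the users (`down`). There are no other links. -/
structure RelayNetwork (M : ℕ) where
  up : User M → ℕ
  down : User M → ℕ

/-- What the relay does in a time slot: listen and transmit simultaneously (full duplex), only
listen, or only transmit. -/
inductive RelayMode
  | duplex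
  | listen
  | transmit
  deriving DecidableEq

instance : Fintype RelayMode where
  elems := {.duplex, .listen, .transmit}
  complete := by intro m; cases m <;> simp

/-- The `q × q` shift matrix over the field with two elements (it moves every entry one level
down). -/
def shift (q : ℕ) : Matrix (Fin q) (Fin q) (ZMod 2) :=
  fun i j => if (i : ℕ) = (j : ℕ) + 1 then 1 else 0

namespace RelayNetwork

variable {M : ℕ} (net : RelayNetwork M)

/-- The gain `n_(k,j)` from node `k` to node `j`. -/
def gain : Node M → Node M → ℕ
  | some u, none => net.up u
  | none, some u => net.down u
  | _, _ => 0

/-- The number of signal levels, `q = max n_(k,j)`. -/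
def q : ℕ := Finset.univ.sup fun p : Node M × Node M => net.gain p.1 p.2

/-- Signal vectors; level `0` is the most significant one. -/
abbrev Vec := Fin net.q → ZMod 2

/-- The gains in effect in a slot: a relay that only listens is not heard, and a relay that only
transmits hears nothing. -/
def gainIn : RelayMode → Node M → Node M → ℕ
  | .duplex, k, j => net.gain k j
  | .listen, k, j => if k = none then 0 else net.gain k j
  | .transmit, k, j => if j = none then 0 else net.gain k j

/-- The deterministic channel: `y_j = ∑_k S^(q - n_(k,j)) x_k`. -/
def channel (m : RelayMode) (x : Node M → net.Vec) (j : Node M) : net.Vec :=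
  ∑ k, (shift net.q ^ (net.q - net.gainIn m k j)) *ᵥ x k

end RelayNetwork

/-- A block code of length `T`. User `u` has one of `size u` messages, meant for its partner. Inputs
may depend on everything the node has received in earlier slots; the sequence of relay modes is
fixed beforehand. -/
structure Code {M : ℕ} (net : RelayNetwork M) where
  T : ℕ
  T_pos : 0 < T
  mode : ℕ → RelayMode
  size : User M → ℕ
  size_pos : ∀ u, 0 < size u
  userEnc : (u : User M) → Fin (size u) → (τ : ℕ) → (Fin τ → net.Vec) → net.Vec
  relayEnc : (τ : ℕ) → (Fin τ → net.Vec) → net.Vec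
  dec : (u : User M) → Fin (size u) → (Fin T → net.Vec) → Fin (size (partner u))

namespace Code

variable {M : ℕ} {net : RelayNetwork M} (c : Code net)

/-- Message tuples. -/
abbrev Messages := (u : User M) → Fin (c.size u)

/-- The input of node `k` in slot `τ`, given its received signals in the slots before `τ`. -/
def send (w : c.Messages) (τ : ℕ) : (k : Node M) → (Fin τ → net.Vec) → net.Vec
  | none, y => c.relayEnc τ y
  | some u, y => c.userEnc u (w u) τ y

/-- The signal received in slot `τ` by each node when the messages are `w`. -/
def received (w : c.Messages) (τ : ℕ) : Node M → net.Vec :=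
  net.channel (c.mode τ) fun k => c.send w τ k fun s => received w s.val k
termination_by τ
decreasing_by exact s.isLt

/-- The message of its partner that user `u` decodes. -/
def decoded (w : c.Messages) (u : User M) : Fin (c.size (partner u)) :=
  c.dec u (w u) fun τ => c.received w τ.val (some u)

open Classical in
/-- The probability, over independent uniform messages, that some user decodes wrongly. -/
noncomputable def errorProb : ℝ :=
  ((Finset.univ.filter fun w : c.Messages => ∃ u, c.decoded w u ≠ w (partner u)).card : ℝ) /
    (Fintype.card c.Messages : ℝ)

/-- The rate, in bits per slot, from user `u` to its partner. -/
noncomputable def rate (u : User M) : ℝ := Real.logb 2 (c.size u) / c.T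

/-- The number of slots of the block in which the relay is in mode `m`. -/
def modeCount (m : RelayMode) : ℕ := ((Finset.range c.T).filter fun τ => c.mode τ = m).card

/-- Each mode `m` takes a fraction `frac m` of the block, up to rounding to an integer number of
slots. -/
def HasFractions (frac : RelayMode → ℝ) : Prop :=
  ∀ m, |(c.modeCount m : ℝ) - frac m * c.T| < 1

/-- Equation forwarding, with time divided into periods of `Q` slots:
messages are bit strings; every bit is sent uncoded, on one level of one slot (`place`); bits of
different pairs never meet on the same level of the relay; the relay only re-orders the received
levels (the equations) and forwards them, within the same or the next period (`fwd`); and a user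
gets each bit of its partner from one received level (`read`), after cancelling at most one bit of
its own (`own`). -/
def IsEquationForwarding (Q : ℕ) : Prop :=
  ∃ (b : User M → ℕ)
    (bits : ∀ u, Fin (c.size u) ≃ (Fin (b u) → ZMod 2))
    (place : ∀ u, Fin (b u) → Fin c.T × Fin net.q)
    (fwd : Fin c.T × Fin net.q → Option (Fin c.T × Fin net.q))
    (read : ∀ u, Fin (b (partner u)) → Fin c.T × Fin net.q)
    (own : ∀ u, Fin (b (partner u)) → Option (Fin (b u))),
    (∀ u, Function.Injective (place u)) ∧
    (∀ (u : User M) (w : Fin (c.size u)) (τ : Fin c.T) (y : Fin τ.val → net.Vec) (l : Fin net.q),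
      c.userEnc u w τ.val y l = ∑ j, if place u j = (τ, l) then bits u w j else 0) ∧
    (∀ (u v : User M) (j : Fin (b u)) (k : Fin (b v)) (l : Fin net.q),
      (place u j).1 = (place v k).1 →
      (shift net.q ^ (net.q - net.up u)) l (place u j).2 ≠ 0 →
      (shift net.q ^ (net.q - net.up v)) l (place v k).2 ≠ 0 →
      u.1 = v.1) ∧
    (∀ a a' e, fwd a = some e → fwd a' = some e → a = a') ∧
    (∀ a e, fwd a = some e → e.1 < a.1 ∧ a.1.val / Q ≤ e.1.val / Q + 1) ∧
    (∀ (τ : Fin c.T) (y : Fin τ.val → net.Vec) (l : Fin net.q),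
      c.relayEnc τ.val y l =
        match fwd (τ, l) with
        | none => 0
        | some e => if h : e.1.val < τ.val then y ⟨e.1.val, h⟩ e.2 else 0) ∧
    (∀ (u : User M) (w : Fin (c.size u)) (y : Fin c.T → net.Vec) (j : Fin (b (partner u))),
      bits (partner u) (c.dec u w y) j =
        y (read u j).1 (read u j).2 + (own u j).elim 0 (bits u w))

end Code

/-- A full-duplex relay listens and transmits all the time. -/
def fullDuplex : RelayMode → ℝ
  | .duplex => 1
  | .listen => 0
  | .transmit => 0

/-- A half-duplex relay listens a fraction `t` of the time and transmits the rest. -/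
def halfDuplex (t : ℝ) : RelayMode → ℝ
  | .duplex => 0
  | .listen => t
  | .transmit => 1 - t

section Regions

variable {M : ℕ} (net : RelayNetwork M)

/-- The capacity region: all rate tuples (`R u` is the rate from `u` to its partner) that can be
approached by codes of arbitrarily large length with arbitrarily small error probability. -/
def capacityRegion (frac : RelayMode → ℝ) : Set (User M → ℝ) :=
  {R | (∀ u, 0 ≤ R u) ∧ ∀ ε : ℝ, 0 < ε → ∀ T₀ : ℕ, ∃ c : Code net,
    c.HasFractions frac ∧ T₀ ≤ c.T ∧ (∀ u, R u - ε ≤ c.rate u) ∧ c.errorProb ≤ ε}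

/-- The rate tuples that can be approached by equation forwarding, without any error. -/
def equationForwardingRegion (frac : RelayMode → ℝ) : Set (User M → ℝ) :=
  {R | (∀ u, 0 ≤ R u) ∧ ∀ ε : ℝ, 0 < ε → ∀ T₀ : ℕ, ∃ c : Code net,
    c.HasFractions frac ∧ T₀ ≤ c.T ∧ (∀ u, R u - ε ≤ c.rate u) ∧ c.errorProb = 0 ∧
    ∃ Q : ℕ, 0 < Q ∧ c.IsEquationForwarding Q}

/-- Shannon entropy, in bits, of `f` under the distribution `p` on a finite type. -/
noncomputable def entropy {α β : Type} [Fintype α] [Fintype β] [DecidableEq β]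
    (p : α → ℝ) (f : α → β) : ℝ :=
  (∑ b, Real.negMulLog (∑ a, if f a = b then p a else 0)) / Real.log 2

/-- Conditional mutual information `I(f ; g | h)`, in bits, under the distribution `p`. -/
noncomputable def condMutualInfo {α β γ δ : Type} [Fintype α]
    [Fintype β] [DecidableEq β] [Fintype γ] [DecidableEq γ] [Fintype δ] [DecidableEq δ]
    (p : α → ℝ) (f : α → β) (g : α → γ) (h : α → δ) : ℝ :=
  entropy p (fun a => (f a, h a)) + entropy p (fun a => (g a, h a))
    - entropy p (fun a => (f a, g a, h a)) - entropy p h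

/-- `I(X_Ω ; Y_Ωᶜ | X_Ωᶜ)` in relay mode `m`, for inputs of all nodes with joint distribution
`p`. -/
noncomputable def cutInfo (m : RelayMode) (p : (Node M → net.Vec) → ℝ) (Ω : Finset (Node M)) : ℝ :=
  condMutualInfo p
    (fun x => fun k : {k // k ∈ Ω} => x k)
    (fun x => fun j : {j // j ∉ Ω} => net.channel m x j)
    (fun x => fun j : {j // j ∉ Ω} => x j)

/-- The cut-set upper bound region: for some input distribution in each mode, the total rate across
each cut is at most the conditional mutual information across it, averaged over the modes. -/
def cutSetRegion (frac : RelayMode → ℝ) : Set (User M → ℝ) :=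
  {R | (∀ u, 0 ≤ R u) ∧ ∃ p : RelayMode → (Node M → net.Vec) → ℝ,
    (∀ m, p m ∈ stdSimplex ℝ (Node M → net.Vec)) ∧
    ∀ Ω : Finset (Node M),
      ∑ u with some u ∈ Ω ∧ some (partner u) ∉ Ω, R u ≤ ∑ m, frac m * cutInfo net m (p m) Ω}

/-- The region cut out by the bounds, one for each choice of a set `I` of pairs and a direction of
communication `d i` in each of them,
`∑_{i ∈ I} R_i ≤ min (a * max_{i ∈ I} n_(source i, relay)) (b * max_{i ∈ I} n_(relay, sink i))`. -/
def gainRegion (a b : ℝ) : Set (User M → ℝ) :=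
  {R | (∀ u, 0 ≤ R u) ∧ ∀ (I : Finset (Fin M)) (d : Fin M → Bool),
    ∑ i ∈ I, R (i, d i) ≤
      min (a * ((I.sup fun i => net.up (i, d i) : ℕ) : ℝ))
        (b * ((I.sup fun i => net.down (partner (i, d i)) : ℕ) : ℝ))}

end Regions

end BiRelay

/-! The cut-set region, the capacity region and the equation forwarding region are all identified
with the explicit gain region.

Cut-set bounds. At most one user of each pair contributes its rate across a cut, so the rates
crossing it are those of a set `I` of pairs with directions `d`. If the cut separates the sources
from everything else, what crosses it is the sum they produce on the lowest relay levels; if it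
separates the sinks from everything else, it is the uppermost levels sent by the relay. This yields
the two bounds of the gain region. Conversely, independent uniform inputs give every cut at least
its largest crossing gain in each active mode, so no other cut adds a constraint
(`cutSetRegion_eq_gainRegion`).

Converse. The same signals, collected over all slots, determine what the sinks receive once the
other messages are fixed, even with feedback. Counting the correctly decoded message tuples then
bounds the code sizes (`Code.sum_logb_size_le`, `capacityRegion_subset`).

Achievability. The `k`-th bits of both users of a pair share one relay level, as an equation over
`ZMod 2`. An equation fits on any level that all the users it involves can reach. These sets of
levels are nested, so Hall's condition needs checking only at thresholds, where it is a bound of the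
gain region (`exists_placement`). Uplink and downlink are placed independently, the relay permutes
levels to match, and each user cancels its own bit (`Schedule.decoded_eq`). -/

namespace BiRelay

/-! ### Powers of the shift matrix -/

section Shift

theorem shift_pow_apply (q k : ℕ) (i j : Fin q) :
    (shift q ^ k) i j = if (i : ℕ) = j + k then 1 else 0 := by
  induction k generalizing i with
  | zero => simp [Matrix.one_apply, Fin.ext_iff]
  | succ k ih =>
    rw [pow_succ', Matrix.mul_apply]
    simp only [ih, shift, ite_mul, one_mul, zero_mul]
    by_cases h : (i : ℕ) = j + (k + 1)
    · rw [if_pos h, Finset.sum_eq_single (⟨j + k, by omega⟩ : Fin q)]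
      · simp; omega
      · intro b _ hb
        simp only [ne_eq, Fin.ext_iff] at hb
        rw [if_neg (by omega)]
      · simp
    · rw [if_neg h]
      refine Finset.sum_eq_zero fun b _ => ?_
      split_ifs <;> first | rfl | omega

theorem shift_pow_mulVec (q k : ℕ) (x : Fin q → ZMod 2) (l : Fin q) :
    ((shift q ^ k) *ᵥ x) l =
      if k ≤ l then x ⟨l - k, (Nat.sub_le _ _).trans_lt l.isLt⟩ else 0 := by
  simp only [Matrix.mulVec, dotProduct, shift_pow_apply, ite_mul, one_mul, zero_mul]
  split_ifs with h
  · rw [Finset.sum_eq_single (⟨l - k, (Nat.sub_le _ _).trans_lt l.isLt⟩ : Fin q)]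
    · rw [if_pos (by simp; omega)]
    · intro b _ hb
      simp only [ne_eq, Fin.ext_iff] at hb
      rw [if_neg (by omega)]
    · simp
  · exact Finset.sum_eq_zero fun b _ => by rw [if_neg (by omega)]

/-- Links of gain 0 enter the channel through this power, so absent and inactive links drop out. -/
theorem shift_pow_self (q : ℕ) : shift q ^ q = 0 := by
  ext i j
  rw [shift_pow_apply, if_neg (by omega)]
  rfl

end Shift

/-! ### The deterministic channel, one node at a time -/

namespace RelayNetwork

variable {M : ℕ} (net : RelayNetwork M)

theorem gain_le_q (k j : Node M) : net.gain k j ≤ net.q :=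
  Finset.le_sup (f := fun p : Node M × Node M => net.gain p.1 p.2) (Finset.mem_univ (k, j))

theorem up_le_q (u : User M) : net.up u ≤ net.q := net.gain_le_q (some u) none

theorem down_le_q (u : User M) : net.down u ≤ net.q := net.gain_le_q none (some u)

theorem channel_relay {m : RelayMode} (hm : m ≠ .transmit) (x : Node M → net.Vec) :
    net.channel m x none = ∑ u, (shift net.q ^ (net.q - net.up u)) *ᵥ x (some u) := by
  rw [channel, Fintype.sum_option]
  cases m <;> simp_all [gainIn, gain, shift_pow_self]

theorem channel_relay_transmit (x : Node M → net.Vec) :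
    net.channel .transmit x none = 0 := by
  simp [channel, gainIn, shift_pow_self]

theorem channel_user {m : RelayMode} (hm : m ≠ .listen) (x : Node M → net.Vec) (u : User M) :
    net.channel m x (some u) = (shift net.q ^ (net.q - net.down u)) *ᵥ x none := by
  rw [channel, Fintype.sum_option]
  cases m <;> simp_all [gainIn, gain, shift_pow_self]

theorem channel_user_listen (x : Node M → net.Vec) (u : User M) :
    net.channel .listen x (some u) = 0 := by
  rw [channel, Fintype.sum_option]
  simp [gainIn, gain, shift_pow_self]

/-- What the users in `S` contribute to the lowest `N` received levels of the relay. -/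
def upSignal (S : Finset (User M)) (N : ℕ) (x : Node M → net.Vec) : Fin N → ZMod 2 :=
  fun h => if hq : (h : ℕ) < net.q then
    (∑ u ∈ S, (shift net.q ^ (net.q - net.up u)) *ᵥ x (some u)) ⟨net.q - 1 - h, by omega⟩ else 0

/-- The uppermost `N` levels sent by the relay. -/
def downSignal (N : ℕ) (v : net.Vec) : Fin N → ZMod 2 :=
  fun h => if hq : (h : ℕ) < net.q then v ⟨h, hq⟩ else 0

variable {net}

theorem channel_relay_congr (m : RelayMode) {S : Finset (User M)} {N : ℕ}
    (hN : ∀ u ∈ S, net.up u ≤ N) {x x' : Node M → net.Vec}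
    (hx : ∀ u ∉ S, x (some u) = x' (some u))
    (hs : m ≠ .transmit → net.upSignal S N x = net.upSignal S N x') :
    net.channel m x none = net.channel m x' none := by
  by_cases hm : m = .transmit
  · subst hm
    rw [channel_relay_transmit, channel_relay_transmit]
  rw [channel_relay _ hm, channel_relay _ hm, ← Finset.sum_add_sum_compl S,
    ← Finset.sum_add_sum_compl S (fun u => (shift net.q ^ (net.q - net.up u)) *ᵥ x' (some u))]
  congr 1
  · ext l
    -- Level `l` from above is level `q - 1 - l` from below; if this is at least `N`, no user in `S`
    -- reaches it.
    by_cases hl : net.q ≤ l + N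
    · have h := congrFun (hs hm) ⟨net.q - 1 - l, by omega⟩
      have hl' : net.q - 1 - (net.q - 1 - (l : ℕ)) = l := by omega
      have hq : net.q - 1 - (l : ℕ) < net.q := by omega
      simpa only [upSignal, hq, dite_true, hl'] using h
    · simp only [Finset.sum_apply, shift_pow_mulVec]
      refine Finset.sum_congr rfl fun u hu => ?_
      have := hN u hu
      rw [if_neg (by omega), if_neg (by omega)]
  · refine Finset.sum_congr rfl fun u hu => ?_
    rw [hx u (by simpa using hu)]

theorem channel_user_congr (m : RelayMode) {N : ℕ} {u : User M} (hN : net.down u ≤ N)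
    {x x' : Node M → net.Vec}
    (hs : m ≠ .listen → net.downSignal N (x none) = net.downSignal N (x' none)) :
    net.channel m x (some u) = net.channel m x' (some u) := by
  by_cases hm : m = .listen
  · subst hm
    rw [channel_user_listen, channel_user_listen]
  rw [channel_user _ hm, channel_user _ hm]
  ext l
  simp only [shift_pow_mulVec]
  split_ifs with h
  · have h := congrFun (hs hm) ⟨l - (net.q - net.down u), by omega⟩
    have hq : (l : ℕ) - (net.q - net.down u) < net.q := by omega
    simpa only [downSignal, hq, dite_true] using h
  · rfl

end RelayNetwork

/-! ### Entropy inequalities -/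

section Entropy

variable {α β γ : Type} [Fintype α] [Fintype β] [DecidableEq β] [Fintype γ] [DecidableEq γ]
  {p : α → ℝ}

/-- Each term has a smaller logarithm than the total, so merging outcomes cannot raise entropy. -/
theorem negMulLog_sum_le {ι : Type*} (s : Finset ι) (f : ι → ℝ) (hf : ∀ i ∈ s, 0 ≤ f i) :
    Real.negMulLog (∑ i ∈ s, f i) ≤ ∑ i ∈ s, Real.negMulLog (f i) := by
  have hS : ∀ i ∈ s, f i ≤ ∑ j ∈ s, f j := fun i hi => Finset.single_le_sum hf hi
  rw [Real.negMulLog, neg_mul, Finset.sum_mul, ← Finset.sum_neg_distrib]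
  refine Finset.sum_le_sum fun i hi => ?_
  rw [Real.negMulLog, neg_mul, neg_le_neg_iff]
  rcases (hf i hi).eq_or_lt with h | h
  · simp [← h]
  · exact mul_le_mul_of_nonneg_left (Real.log_le_log h (hS i hi)) h.le

/-- A variable that is a function of another one has at most its entropy. -/
theorem entropy_le_of_determines (hp : ∀ a, 0 ≤ p a) (f : α → β) (g : α → γ)
    (h : ∀ a a', f a = f a' → g a = g a') : entropy p g ≤ entropy p f := by
  classical
  refine div_le_div_of_nonneg_right ?_ (Real.log_nonneg one_le_two)
  by_cases hα : Nonempty α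
  swap
  · rw [not_nonempty_iff] at hα
    simp
  obtain ⟨a₀⟩ := hα
  -- `g` factors through `f` as `φ ∘ f`. Values outside the range of `f` have probability 0, so the
  -- default is harmless.
  let φ : β → γ := fun b => if hb : ∃ a, f a = b then g hb.choose else g a₀
  have hφ : ∀ a, φ (f a) = g a := fun a => by
    have hb : ∃ a', f a' = f a := ⟨a, rfl⟩
    simp only [φ, hb, dite_true]
    exact h _ _ hb.choose_spec
  rw [← Finset.sum_fiberwise (s := Finset.univ) (g := φ)]
  refine Finset.sum_le_sum fun c _ => ?_
  refine le_trans (le_of_eq ?_) (negMulLog_sum_le _ _ fun b _ =>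
    Finset.sum_nonneg fun a _ => by split_ifs <;> simp [hp])
  congr 1
  rw [Finset.sum_comm]
  refine Finset.sum_congr rfl fun a _ => ?_
  rw [Finset.sum_ite_eq]
  simp [hφ]

theorem entropy_eq_of_determines (hp : ∀ a, 0 ≤ p a) (f : α → β) (g : α → γ)
    (h : ∀ a a', f a = f a' ↔ g a = g a') : entropy p f = entropy p g :=
  le_antisymm (entropy_le_of_determines hp g f fun a a' => (h a a').2)
    (entropy_le_of_determines hp f g fun a a' => (h a a').1)

/-- Jensen's inequality for the concave `Real.negMulLog` with equal weights. The masses need not sum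
to 1, so that the bound applies to each fibre in the chain rule. -/
theorem sum_negMulLog_le {γ : Type*} [Fintype γ] (f : γ → ℝ) (hf : ∀ c, 0 ≤ f c) :
    ∑ c, Real.negMulLog (f c) ≤
      Real.negMulLog (∑ c, f c) + (∑ c, f c) * Real.log (Fintype.card γ) := by
  by_cases hγ : Nonempty γ
  swap
  · rw [not_nonempty_iff] at hγ
    simp
  have hn : (0 : ℝ) < Fintype.card γ := by exact_mod_cast Fintype.card_pos
  have h := Real.concaveOn_negMulLog.le_map_sum (t := Finset.univ)
    (w := fun _ : γ => (Fintype.card γ : ℝ)⁻¹) (p := f) (fun _ _ => by positivity)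
    (by simp [hn.ne']) (fun c _ => hf c)
  simp only [smul_eq_mul, ← Finset.mul_sum] at h
  rcases (Finset.sum_nonneg fun c (_ : c ∈ Finset.univ) => hf c).eq_or_lt with hs | hs
  · rw [← hs] at h ⊢
    simp only [mul_zero, Real.negMulLog_zero] at h
    have := (mul_le_mul_iff_right₀ (inv_pos.2 hn)).1 (h.trans_eq (mul_zero _).symm)
    simpa using this
  · rw [Real.negMulLog, Real.log_mul (inv_pos.2 hn).ne' hs.ne', Real.log_inv] at h
    refine (mul_le_mul_iff_right₀ (inv_pos.2 hn)).1 (h.trans_eq ?_)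
    rw [Real.negMulLog]
    ring

theorem sum_prob (f : α → β) : ∑ b, (∑ a, if f a = b then p a else 0) = ∑ a, p a := by
  rw [Finset.sum_comm]
  simp

/-- Chain rule bound: an additional variable adds at most the logarithm of the number of its
values. -/
theorem entropy_prod_le (hp : p ∈ stdSimplex ℝ α) (f : α → γ) (g : α → β) :
    entropy p (fun a => (f a, g a)) ≤ entropy p g + Real.logb 2 (Fintype.card γ) := by
  rw [entropy, entropy, Real.logb, ← add_div]
  refine div_le_div_of_nonneg_right ?_ (Real.log_nonneg one_le_two)
  rw [Fintype.sum_prod_type, Finset.sum_comm]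
  have hsum : ∀ b, ∑ c, (∑ a, if (f a, g a) = (c, b) then p a else 0)
      = ∑ a, if g a = b then p a else 0 := fun b => by
    rw [Finset.sum_comm]
    refine Finset.sum_congr rfl fun a _ => ?_
    simp [Prod.ext_iff, ite_and]
  refine (Finset.sum_le_sum fun b _ => sum_negMulLog_le _ fun c =>
    Finset.sum_nonneg fun a _ => by split_ifs <;> simp [hp.1]).trans_eq ?_
  simp_rw [hsum]
  rw [Finset.sum_add_distrib, ← Finset.sum_mul, sum_prob, hp.2, one_mul]

theorem entropy_le_logb_card (hp : p ∈ stdSimplex ℝ α) (f : α → γ) :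
    entropy p f ≤ Real.logb 2 (Fintype.card γ) := by
  have h0 : entropy p (fun _ => ()) = 0 := by
    rw [entropy, Fintype.sum_unique]
    simp only [if_true, hp.2, Real.negMulLog_one, zero_div]
  calc entropy p f ≤ entropy p (fun a => (f a, ())) :=
        entropy_le_of_determines hp.1 _ _ fun a a' haa' => (Prod.ext_iff.1 haa').1
    _ ≤ entropy p (fun _ => ()) + Real.logb 2 (Fintype.card γ) := entropy_prod_le hp f _
    _ = _ := by rw [h0, zero_add]

theorem uniform_mem_stdSimplex [Nonempty α] :
    (fun _ : α => (Fintype.card α : ℝ)⁻¹) ∈ stdSimplex ℝ α :=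
  ⟨fun _ => by positivity, by simp⟩

theorem entropy_uniform [Nonempty α] [DecidableEq α] :
    entropy (fun _ : α => (Fintype.card α : ℝ)⁻¹) (fun a => a)
      = Real.logb 2 (Fintype.card α) := by
  have hn : (Fintype.card α : ℝ) ≠ 0 := by exact_mod_cast Fintype.card_ne_zero
  have h : ∀ b : α, (∑ a, if a = b then (Fintype.card α : ℝ)⁻¹ else 0)
      = (Fintype.card α : ℝ)⁻¹ := fun b => by simp
  rw [entropy, Finset.sum_congr rfl fun b _ => by rw [h b], Finset.sum_const, Finset.card_univ,
    nsmul_eq_mul, Real.negMulLog, Real.log_inv, Real.logb]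
  congr 1
  field_simp

end Entropy

/-! ### Conditional mutual information of noiseless channels -/

section CondMutualInfo

variable {α β γ δ ζ : Type} [Fintype α] [Fintype β] [DecidableEq β] [Fintype γ] [DecidableEq γ]
  [Fintype δ] [DecidableEq δ] [Fintype ζ] [DecidableEq ζ] {p : α → ℝ}

/-- Without noise the output carries no entropy beyond that of the inputs. -/
theorem condMutualInfo_eq (hp : ∀ a, 0 ≤ p a) (f : α → β) (g : α → γ) (h : α → δ)
    (hg : ∀ a a', f a = f a' → h a = h a' → g a = g a') :
    condMutualInfo p f g h = entropy p (fun a => (g a, h a)) - entropy p h := by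
  have := entropy_eq_of_determines hp (fun a => (f a, h a)) (fun a => (f a, g a, h a))
    fun a a' => by
      simp only [Prod.mk.injEq]
      exact ⟨fun ⟨h1, h2⟩ => ⟨h1, hg a a' h1 h2, h2⟩, fun ⟨h1, _, h2⟩ => ⟨h1, h2⟩⟩
  rw [condMutualInfo, this]
  ring

theorem condMutualInfo_nonneg (hp : ∀ a, 0 ≤ p a) (f : α → β) (g : α → γ) (h : α → δ)
    (hg : ∀ a a', f a = f a' → h a = h a' → g a = g a') : 0 ≤ condMutualInfo p f g h := by
  rw [condMutualInfo_eq hp f g h hg, sub_nonneg]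
  exact entropy_le_of_determines hp _ _ fun a a' haa' => (Prod.ext_iff.1 haa').2

theorem condMutualInfo_le (hp : p ∈ stdSimplex ℝ α) (f : α → β) (g : α → γ) (h : α → δ)
    (hg : ∀ a a', f a = f a' → h a = h a' → g a = g a') (z : α → ζ)
    (hz : ∀ a a', z a = z a' → h a = h a' → g a = g a') :
    condMutualInfo p f g h ≤ Real.logb 2 (Fintype.card ζ) := by
  rw [condMutualInfo_eq hp.1 f g h hg, sub_le_iff_le_add']
  refine le_trans ?_ (entropy_prod_le hp z h)
  refine entropy_le_of_determines hp.1 _ _ fun a a' haa' => ?_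
  simp only [Prod.mk.injEq] at haa' ⊢
  exact ⟨hz a a' haa'.1 haa'.2, haa'.2⟩

/-- The uniform point has full entropy and is recovered from `z`, `g` and `h`. The variable `z`
collects what the output may fail to reveal, at a cost of at most the logarithm of its number of
values. -/
theorem logb_card_le_condMutualInfo_uniform [Nonempty α] [DecidableEq α]
    (f : α → β) (g : α → γ) (h : α → δ)
    (hg : ∀ a a', f a = f a' → h a = h a' → g a = g a') (z : α → ζ)
    (hz : ∀ a a', z a = z a' → g a = g a' → h a = h a' → a = a') :
    Real.logb 2 (Fintype.card α) ≤ condMutualInfo (fun _ => (Fintype.card α : ℝ)⁻¹) f g h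
      + Real.logb 2 (Fintype.card δ) + Real.logb 2 (Fintype.card ζ) := by
  have hp := uniform_mem_stdSimplex (α := α)
  rw [condMutualInfo_eq hp.1 f g h hg]
  have h1 := entropy_le_logb_card hp h
  have h2 := entropy_prod_le hp z (fun a => (g a, h a))
  have h3 := entropy_le_of_determines hp.1 (fun a => (z a, g a, h a)) (fun a => a)
    fun a a' haa' => by
      simp only [Prod.mk.injEq] at haa'
      exact hz a a' haa'.1 haa'.2.1 haa'.2.2
  rw [entropy_uniform] at h3
  linarith

end CondMutualInfo

theorem logb_card_signals (N : ℕ) : Real.logb 2 (Fintype.card (Fin N → ZMod 2)) = N := by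
  rw [Fintype.card_fun, ZMod.card, Fintype.card_fin]
  push_cast
  rw [Real.logb_pow, Real.logb_self_eq_one one_lt_two, mul_one]

/-! ### Bounds on the information across a cut -/

section CutInfo

variable {M : ℕ} (net : RelayNetwork M)

theorem received_determined (m : RelayMode) (Ω : Finset (Node M)) (x x' : Node M → net.Vec)
    (h1 : (fun k : {k // k ∈ Ω} => x k) = fun k : {k // k ∈ Ω} => x' k)
    (h2 : (fun j : {j // j ∉ Ω} => x j) = fun j : {j // j ∉ Ω} => x' j) :
    (fun j : {j // j ∉ Ω} => net.channel m x j) =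
      fun j : {j // j ∉ Ω} => net.channel m x' j := by
  have : x = x' := by
    funext k
    by_cases hk : k ∈ Ω
    · exact congrFun h1 ⟨k, hk⟩
    · exact congrFun h2 ⟨k, hk⟩
  rw [this]

theorem cutInfo_nonneg (m : RelayMode) {p : (Node M → net.Vec) → ℝ} (hp : ∀ x, 0 ≤ p x)
    (Ω : Finset (Node M)) : 0 ≤ cutInfo net m p Ω :=
  condMutualInfo_nonneg hp _ _ _ (received_determined net m Ω)

/-- The cut information is at most the number of bits that cross the cut. -/
theorem cutInfo_le (m : RelayMode) {p : (Node M → net.Vec) → ℝ} (hp : p ∈ stdSimplex ℝ _)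
    (Ω : Finset (Node M)) (N : ℕ) (z : (Node M → net.Vec) → Fin N → ZMod 2)
    (hz : ∀ x x', z x = z x' → (∀ j ∉ Ω, x j = x' j) →
      ∀ j ∉ Ω, net.channel m x j = net.channel m x' j) :
    cutInfo net m p Ω ≤ N := by
  rw [← logb_card_signals N]
  refine condMutualInfo_le hp _ _ _ (received_determined net m Ω) z fun x x' h1 h2 => ?_
  funext j
  exact hz x x' h1 (fun j hj => congrFun h2 ⟨j, hj⟩) j j.2

/-- The distribution of independent uniform inputs. -/
noncomputable def uniformInput : (Node M → net.Vec) → ℝ :=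
  fun _ => (Fintype.card (Node M → net.Vec) : ℝ)⁻¹

theorem uniformInput_mem : uniformInput net ∈ stdSimplex ℝ (Node M → net.Vec) :=
  uniform_mem_stdSimplex

/-- Under uniform inputs, the cut information is at least the number of signal levels of a node
that can be recovered across the cut. -/
theorem le_cutInfo_uniformInput (m : RelayMode) (Ω : Finset (Node M)) (k : Node M) (hk : k ∈ Ω)
    (n : ℕ) (hn : n ≤ net.q)
    (hdet : ∀ x x' : Node M → net.Vec, (∀ j, j ≠ k → x j = x' j) →
      (∀ j ∉ Ω, net.channel m x j = net.channel m x' j) →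
      ∀ l : Fin net.q, (l : ℕ) < n → x k l = x' k l) :
    (n : ℝ) ≤ cutInfo net m (uniformInput net) Ω := by
  have h := logb_card_le_condMutualInfo_uniform
    (fun x : Node M → net.Vec => fun k : {k // k ∈ Ω} => x k)
    (fun x => fun j : {j // j ∉ Ω} => net.channel m x j)
    (fun x => fun j : {j // j ∉ Ω} => x j) (received_determined net m Ω)
    -- Everything on the sending side except the first `n` levels of node `k`.
    (fun x => ((fun j : {j // j ∈ Ω.erase k} => x j), fun l : {l : Fin net.q // n ≤ l} => x k l))
    fun x x' h1 h5 h6 => by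
      obtain ⟨h3, h4⟩ := Prod.ext_iff.1 h1
      have hne : ∀ j, j ≠ k → x j = x' j := fun j hj => by
        by_cases hjΩ : j ∈ Ω
        · exact congrFun h3 ⟨j, Finset.mem_erase.2 ⟨hj, hjΩ⟩⟩
        · exact congrFun h6 ⟨j, hjΩ⟩
      funext j
      by_cases hj : j = k
      · subst hj
        funext l
        by_cases hl : n ≤ l
        · exact congrFun h4 ⟨l, hl⟩
        · exact hdet x x' hne (fun j hj => congrFun h5 ⟨j, hj⟩) l (by omega)
      · exact hne j hj
  change _ ≤ cutInfo net m (uniformInput net) Ω + _ + _ at h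
  have hΩ : 1 ≤ Ω.card := Finset.card_pos.2 ⟨k, hk⟩
  have hΩ' : Ω.card ≤ Fintype.card (Node M) := Finset.card_le_univ Ω
  have hlow : Fintype.card {l : Fin net.q // n ≤ l} = net.q - n := by
    rw [Fintype.card_subtype]
    have : (Finset.univ.filter fun l : Fin net.q => ¬ n ≤ (l : ℕ)).card = n := by
      simp only [not_le, Fin.card_filter_val_lt]
      omega
    have h := Finset.card_filter_add_card_filter_not (s := (Finset.univ : Finset (Fin net.q)))
      (fun l => n ≤ (l : ℕ))
    rw [this, Finset.card_univ, Fintype.card_fin] at h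
    omega
  -- After the inputs outside the cut and the side information are removed, exactly `n` bits of the
  -- uniform input remain.
  have hcard : Fintype.card (Node M → net.Vec) = Fintype.card ({j // j ∉ Ω} → net.Vec) *
      Fintype.card (({j // j ∈ Ω.erase k} → net.Vec) × ({l : Fin net.q // n ≤ l} → ZMod 2))
      * 2 ^ n := by
    rw [Fintype.card_prod]
    simp only [Fintype.card_fun, ZMod.card, Fintype.card_fin, hlow, Fintype.card_coe,
      Finset.card_erase_of_mem hk, Fintype.card_subtype_compl]
    rw [mul_assoc, mul_assoc, ← pow_add, Nat.sub_add_cancel hn, ← pow_succ,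
      Nat.sub_add_cancel hΩ, ← pow_add, Nat.sub_add_cancel hΩ']
  have hpos : ∀ (δ : Type) [Fintype δ] [Nonempty δ], (Fintype.card δ : ℝ) ≠ 0 :=
    fun δ _ _ => by exact_mod_cast Fintype.card_ne_zero
  rw [hcard, Nat.cast_mul, Nat.cast_mul, Real.logb_mul (mul_ne_zero (hpos _) (hpos _))
    (by positivity), Real.logb_mul (hpos _) (hpos _), Nat.cast_pow, Nat.cast_two, Real.logb_pow,
    Real.logb_self_eq_one one_lt_two] at h
  linarith

end CutInfo

/-! ### The cut-set region is the gain region -/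

section CutSet

variable {M : ℕ} (net : RelayNetwork M) {frac : RelayMode → ℝ}

open RelayNetwork

theorem sum_relayMode (f : RelayMode → ℝ) : ∑ m, f m = f .duplex + f .listen + f .transmit := by
  rw [show (Finset.univ : Finset RelayMode) = {.duplex, .listen, .transmit} from rfl,
    Finset.sum_insert (by simp), Finset.sum_insert (by simp), Finset.sum_singleton, add_assoc]

/-- The sources of the pairs in `I`, for the directions `d`. -/
def sources (I : Finset (Fin M)) (d : Fin M → Bool) : Finset (User M) :=
  I.image fun i => (i, d i)

theorem mem_sources {I : Finset (Fin M)} {d : Fin M → Bool} {u : User M} :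
    u ∈ sources I d ↔ u.1 ∈ I ∧ u.2 = d u.1 := by
  rw [sources, Finset.mem_image]
  constructor
  · rintro ⟨i, hi, rfl⟩
    exact ⟨hi, rfl⟩
  · rintro ⟨h1, h2⟩
    exact ⟨u.1, h1, Prod.ext rfl h2.symm⟩

theorem sum_sources (I : Finset (Fin M)) (d : Fin M → Bool) (R : User M → ℝ) :
    ∑ u ∈ sources I d, R u = ∑ i ∈ I, R (i, d i) :=
  Finset.sum_image fun _ _ _ _ h => (Prod.ext_iff.1 h).1

theorem partner_partner (u : User M) : partner (partner u) = u := by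
  simp [partner]

theorem cutSetRegion_subset (hfrac : ∀ m, 0 ≤ frac m) :
    cutSetRegion net frac ⊆ gainRegion net (frac .duplex + frac .listen)
      (frac .duplex + frac .transmit) := by
  rintro R ⟨hR, p, hp, hcut⟩
  refine ⟨hR, fun I d => le_min ?_ ?_⟩
  · set N := I.sup fun i => net.up (i, d i)
    have hN : ∀ u ∈ sources I d, net.up u ≤ N := fun u hu => by
      obtain ⟨h1, h2⟩ := mem_sources.1 hu
      rw [show u = (u.1, d u.1) from Prod.ext rfl h2]
      exact Finset.le_sup (f := fun i => net.up (i, d i)) h1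
    -- Uplink bound: only the sources lie on the sending side.
    have h := hcut ((sources I d).map Function.Embedding.some)
    have hS : (Finset.univ.filter fun u : User M =>
        some u ∈ (sources I d).map Function.Embedding.some ∧
        some (partner u) ∉ (sources I d).map Function.Embedding.some) = sources I d := by
      ext u
      simp only [Finset.mem_filter, Finset.mem_univ, true_and, Finset.mem_map,
        Function.Embedding.some_apply, Option.some.injEq, exists_eq_right, mem_sources]
      cases u.2 <;> cases d u.1 <;> simp
    rw [hS, sum_sources, sum_relayMode] at h
    have hle : ∀ m, m ≠ .transmit →
        cutInfo net m (p m) ((sources I d).map Function.Embedding.some) ≤ N := fun m hm => by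
      refine cutInfo_le net m (hp m) _ N (net.upSignal (sources I d) N) fun x x' hz hx j hj => ?_
      have hx' : ∀ u ∉ sources I d, x (some u) = x' (some u) := fun u hu =>
        hx _ (by simpa using hu)
      have hnone : x none = x' none := hx _ (by simp)
      cases j with
      | none => exact channel_relay_congr m hN hx' fun _ => hz
      | some u => exact channel_user_congr m (le_refl _) fun _ => by rw [hnone]
    have ht : cutInfo net .transmit (p .transmit) ((sources I d).map Function.Embedding.some)
        ≤ 0 := by
      have := cutInfo_le net .transmit (hp .transmit)
        ((sources I d).map Function.Embedding.some) 0 (fun _ => 0) fun x x' hz hx j hj => by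
          cases j with
          | none => rw [channel_relay_transmit, channel_relay_transmit]
          | some u => exact channel_user_congr _ (le_refl _) fun _ => by rw [hx none (by simp)]
      simpa using this
    have h1 := mul_le_mul_of_nonneg_left (hle .duplex (by simp)) (hfrac .duplex)
    have h2 := mul_le_mul_of_nonneg_left (hle .listen (by simp)) (hfrac .listen)
    have h3 := mul_le_mul_of_nonneg_left ht (hfrac .transmit)
    linarith
  · set N := I.sup fun i => net.down (partner (i, d i))
    -- Downlink bound: only the sinks, which are the sources for the reversed directions, lie on the
    -- receiving side.
    set Ω : Finset (Node M) :=
      ((sources I fun i => !d i).map Function.Embedding.some)ᶜ with hΩ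
    have hmem : ∀ u : User M, some u ∉ Ω ↔ u ∈ sources I fun i => !d i := fun u => by
      simp [hΩ]
    have hN : ∀ u : User M, some u ∉ Ω → net.down u ≤ N := fun u hu => by
      obtain ⟨h1, h2⟩ := mem_sources.1 ((hmem u).1 hu)
      rw [show u = partner (u.1, d u.1) from Prod.ext rfl h2]
      exact Finset.le_sup (f := fun i => net.down (partner (i, d i))) h1
    have hnone : none ∈ Ω := by simp [hΩ]
    have h := hcut Ω
    have hS : (Finset.univ.filter fun u : User M => some u ∈ Ω ∧ some (partner u) ∉ Ω)
        = sources I d := by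
      ext u
      rw [Finset.mem_filter, ← not_not (a := some u ∈ Ω), hmem, hmem, mem_sources, mem_sources,
        mem_sources]
      cases hu : u.2 <;> cases d u.1 <;> simp [hu]
    rw [hS, sum_sources, sum_relayMode] at h
    have hle : ∀ m, m ≠ .listen → cutInfo net m (p m) Ω ≤ N := fun m hm => by
      refine cutInfo_le net m (hp m) _ N (fun x => net.downSignal N (x none))
        fun x x' hz hx j hj => ?_
      cases j with
      | none => exact absurd hnone hj
      | some u => exact channel_user_congr m (hN u hj) fun _ => hz
    have ht : cutInfo net .listen (p .listen) Ω ≤ 0 := by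
      have := cutInfo_le net .listen (hp .listen) Ω 0 (fun _ => 0) fun x x' hz hx j hj => by
          cases j with
          | none => exact absurd hnone hj
          | some u => rw [channel_user_listen, channel_user_listen]
      simpa using this
    have h1 := mul_le_mul_of_nonneg_left (hle .duplex (by simp)) (hfrac .duplex)
    have h2 := mul_le_mul_of_nonneg_left (hle .transmit (by simp)) (hfrac .transmit)
    have h3 := mul_le_mul_of_nonneg_left ht (hfrac .listen)
    linarith

/-- With all other inputs fixed, their contributions at the relay cancel, and the shifted input of
`u` shows its first `up u` levels. -/
theorem le_cutInfo_up {m : RelayMode} (hm : m ≠ .transmit) {Ω : Finset (Node M)}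
    (hΩ : none ∉ Ω) {u : User M} (hu : some u ∈ Ω) :
    (net.up u : ℝ) ≤ cutInfo net m (uniformInput net) Ω := by
  refine le_cutInfo_uniformInput net m Ω (some u) hu _ (net.up_le_q u) fun x x' hx hy l hl => ?_
  have h := hy none hΩ
  rw [channel_relay _ hm, channel_relay _ hm, ← Finset.add_sum_erase _ _ (Finset.mem_univ u),
    ← Finset.add_sum_erase _ (fun u => (shift net.q ^ (net.q - net.up u)) *ᵥ x' (some u))
      (Finset.mem_univ u)] at h
  rw [Finset.sum_congr rfl fun v hv => by
    rw [hx (some v) (by simpa using (Finset.mem_erase.1 hv).1)], add_left_inj] at h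
  have hq := net.up_le_q u
  have h' := congrFun h ⟨l + (net.q - net.up u), by omega⟩
  simpa [shift_pow_mulVec] using h'

theorem le_cutInfo_down {m : RelayMode} (hm : m ≠ .listen) {Ω : Finset (Node M)}
    (hΩ : none ∈ Ω) {u : User M} (hu : some u ∉ Ω) :
    (net.down u : ℝ) ≤ cutInfo net m (uniformInput net) Ω := by
  refine le_cutInfo_uniformInput net m Ω none hΩ _ (net.down_le_q u) fun x x' hx hy l hl => ?_
  have h := hy (some u) hu
  rw [channel_user _ hm, channel_user _ hm] at h
  have hq := net.down_le_q u
  have h' := congrFun h ⟨l + (net.q - net.down u), by omega⟩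
  simpa [shift_pow_mulVec] using h'

theorem cast_sup_le {ι : Type*} (I : Finset ι) (g : ι → ℕ) {c : ℝ} (hc : 0 ≤ c)
    (h : ∀ i ∈ I, (g i : ℝ) ≤ c) : ((I.sup g : ℕ) : ℝ) ≤ c := by
  have : I.sup g ≤ ⌊c⌋₊ := Finset.sup_le fun i hi => Nat.le_floor (h i hi)
  exact (Nat.cast_le.2 this).trans (Nat.floor_le hc)

/-- The same uniform input serves all cuts and modes. The side of the cut on which the relay lies
decides whether the uplink or the downlink bound is used. -/
theorem gainRegion_subset (hfrac : ∀ m, 0 ≤ frac m) :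
    gainRegion net (frac .duplex + frac .listen) (frac .duplex + frac .transmit) ⊆
      cutSetRegion net frac := by
  rintro R ⟨hR, hgain⟩
  refine ⟨hR, fun _ => uniformInput net, fun _ => uniformInput_mem net, fun Ω => ?_⟩
  have h0 : ∀ m, 0 ≤ cutInfo net m (uniformInput net) Ω := fun m =>
    cutInfo_nonneg net m (uniformInput_mem net).1 Ω
  -- If a pair is split by the cut, this direction starts at its user inside `Ω`; unsplit pairs are
  -- left out of `I`.
  let d : Fin M → Bool := fun i => decide (some (i, true) ∈ Ω)
  let I : Finset (Fin M) := Finset.univ.filter fun i =>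
    some (i, d i) ∈ Ω ∧ some (partner (i, d i)) ∉ Ω
  have hS : (Finset.univ.filter fun u : User M => some u ∈ Ω ∧ some (partner u) ∉ Ω)
      = sources I d := by
    ext ⟨i, b⟩
    simp only [Finset.mem_filter, Finset.mem_univ, true_and, mem_sources, I, d]
    by_cases h1 : some (i, true) ∈ Ω <;> by_cases h2 : some (i, false) ∈ Ω <;>
      cases b <;> simp [partner, h1, h2]
  rw [hS, sum_sources, sum_relayMode]
  obtain ⟨h1, h2⟩ := le_min_iff.1 (hgain I d)
  have hI : ∀ i ∈ I, some (i, d i) ∈ Ω ∧ some (partner (i, d i)) ∉ Ω := fun i hi =>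
    (Finset.mem_filter.1 hi).2
  by_cases hΩ : none ∈ Ω
  · have hb : ∀ m, m ≠ .listen →
        ((I.sup fun i => net.down (partner (i, d i)) : ℕ) : ℝ)
          ≤ cutInfo net m (uniformInput net) Ω := fun m hm =>
      cast_sup_le _ _ (h0 m) fun i hi => le_cutInfo_down net hm hΩ (hI i hi).2
    have h3 := mul_le_mul_of_nonneg_left (hb .duplex (by simp)) (hfrac .duplex)
    have h4 := mul_le_mul_of_nonneg_left (hb .transmit (by simp)) (hfrac .transmit)
    have h5 := mul_nonneg (hfrac .listen) (h0 .listen)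
    linarith
  · have hb : ∀ m, m ≠ .transmit →
        ((I.sup fun i => net.up (i, d i) : ℕ) : ℝ)
          ≤ cutInfo net m (uniformInput net) Ω := fun m hm =>
      cast_sup_le _ _ (h0 m) fun i hi => le_cutInfo_up net hm hΩ (hI i hi).1
    have h3 := mul_le_mul_of_nonneg_left (hb .duplex (by simp)) (hfrac .duplex)
    have h4 := mul_le_mul_of_nonneg_left (hb .listen (by simp)) (hfrac .listen)
    have h5 := mul_nonneg (hfrac .transmit) (h0 .transmit)
    linarith

theorem cutSetRegion_eq_gainRegion (hfrac : ∀ m, 0 ≤ frac m) :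
    cutSetRegion net frac = gainRegion net (frac .duplex + frac .listen)
      (frac .duplex + frac .transmit) :=
  (cutSetRegion_subset net hfrac).antisymm (gainRegion_subset net hfrac)

end CutSet

/-! ### Counting bounds for arbitrary codes -/

namespace Code

variable {M : ℕ} {net : RelayNetwork M} (c : Code net)

open RelayNetwork

/-- What node `k` sends in slot `τ` when the messages are `w`. -/
def input (w : c.Messages) (τ : ℕ) (k : Node M) : net.Vec :=
  c.send w τ k fun s => c.received w s.val k

theorem received_eq (w : c.Messages) (τ : ℕ) :
    c.received w τ = net.channel (c.mode τ) (c.input w τ) := by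
  rw [received]
  rfl

theorem input_relay_congr {w w' : c.Messages} {τ : ℕ}
    (h : ∀ s < τ, c.received w s none = c.received w' s none) :
    c.input w τ none = c.input w' τ none := by
  have : (fun s : Fin τ => c.received w s.val none) = fun s : Fin τ => c.received w' s.val none :=
    funext fun s => h s s.isLt
  rw [input, input, this]
  rfl

theorem input_user_congr {w w' : c.Messages} {τ : ℕ} {u : User M} (hu : w u = w' u)
    (h : ∀ s < τ, c.received w s (some u) = c.received w' s (some u)) :
    c.input w τ (some u) = c.input w' τ (some u) := by
  have : (fun s : Fin τ => c.received w s.val (some u)) =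
    fun s : Fin τ => c.received w' s.val (some u) := funext fun s => h s s.isLt
  rw [input, input, this]
  simp only [send, hu]

theorem decoded_congr {w w' : c.Messages} {u : User M} (hu : w u = w' u)
    (h : ∀ s < c.T, c.received w s (some u) = c.received w' s (some u)) :
    c.decoded w u = c.decoded w' u := by
  have : (fun s : Fin c.T => c.received w s.val (some u)) =
    fun s : Fin c.T => c.received w' s.val (some u) := funext fun s => h s s.isLt
  rw [decoded, decoded, this, hu]

/-- What the relay receives from the users in `S` determines all received signals outside `S`. -/
theorem received_congr_of_upSignal {w w' : c.Messages} {S : Finset (User M)} {N T : ℕ}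
    (hN : ∀ u ∈ S, net.up u ≤ N) (hw : ∀ u ∉ S, w u = w' u)
    (hs : ∀ τ < T, c.mode τ ≠ .transmit →
      net.upSignal S N (c.input w τ) = net.upSignal S N (c.input w' τ)) :
    ∀ τ < T, ∀ k : Node M, c.received w τ k = c.received w' τ k := by
  intro τ
  -- Feedback is harmless: outside `S`, inputs depend only on common messages and on earlier
  -- receptions, which agree by induction. Inputs in `S` matter only through their signal at the
  -- relay.
  induction τ using Nat.strong_induction_on with
  | _ τ ih =>
    intro hτ k
    have ih' : ∀ s < τ, ∀ k : Node M, c.received w s k = c.received w' s k :=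
      fun s hs k => ih s hs (hs.trans hτ) k
    rw [received_eq, received_eq]
    cases k with
    | none =>
      exact channel_relay_congr _ hN
        (fun u hu => c.input_user_congr (hw u hu) fun s hs => ih' s hs _) (hs τ hτ)
    | some u =>
      exact channel_user_congr _ le_rfl fun _ => by
        rw [c.input_relay_congr fun s hs => ih' s hs none]

theorem received_congr_of_downSignal {w w' : c.Messages} {u : User M} {N T : ℕ}
    (hN : net.down u ≤ N)
    (hs : ∀ τ < T, c.mode τ ≠ .listen →
      net.downSignal N (c.input w τ none) = net.downSignal N (c.input w' τ none)) :
    ∀ τ < T, c.received w τ (some u) = c.received w' τ (some u) := by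
  intro τ hτ
  rw [received_eq, received_eq]
  exact channel_user_congr _ hN (hs τ hτ)

/-- All users decode correctly. -/
def Correct (w : c.Messages) : Prop := ∀ u, c.decoded w u = w (partner u)

-- At least half of the message tuples are decoded correctly. The factor 2 becomes the additive 1 in
-- the bit counts below.
open Classical in
theorem card_messages_le (he : c.errorProb ≤ 1 / 2) :
    Fintype.card c.Messages ≤ 2 * (Finset.univ.filter fun w : c.Messages => c.Correct w).card := by
  have : ∀ u, Nonempty (Fin (c.size u)) := fun u => ⟨⟨0, c.size_pos u⟩⟩
  have hpos : (0 : ℝ) < Fintype.card c.Messages := by exact_mod_cast Fintype.card_pos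
  rw [errorProb, div_le_iff₀ hpos] at he
  have h := Finset.card_filter_add_card_filter_not (s := (Finset.univ : Finset c.Messages))
    (fun w => c.Correct w)
  have h2 : (Finset.univ.filter fun w : c.Messages => ∃ u, c.decoded w u ≠ w (partner u))
      = Finset.univ.filter fun w : c.Messages => ¬ c.Correct w := by
    simp only [Correct, not_forall, ne_eq]
  rw [h2] at he
  rw [Finset.card_univ] at h
  have h3 : ((Finset.univ.filter fun w : c.Messages => c.Correct w).card : ℝ) +
      (Finset.univ.filter fun w : c.Messages => ¬ c.Correct w).card
      = Fintype.card c.Messages := by exact_mod_cast h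
  have : (Fintype.card c.Messages : ℝ) ≤
      2 * (Finset.univ.filter fun w : c.Messages => c.Correct w).card := by linarith
  exact_mod_cast this

/-- If a signal `F` of `n` bits reveals the messages of the users in `S`, given all the other
messages, then these users together send at most `n + 1` bits. -/
theorem sum_logb_size_le (he : c.errorProb ≤ 1 / 2) (S : Finset (User M)) {κ : Type} [Fintype κ]
    (n : ℕ) (hκ : Fintype.card κ = 2 ^ n) (F : c.Messages → κ)
    (hF : ∀ w w', c.Correct w → c.Correct w' → (∀ u ∉ S, w u = w' u) → F w = F w' → w = w') :
    ∑ u ∈ S, Real.logb 2 (c.size u) ≤ n + 1 := by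
  classical
  -- On correct tuples, the signal together with the messages outside `S` is an injective label.
  have h1 : (Finset.univ.filter fun w : c.Messages => c.Correct w).card ≤
      Fintype.card (κ × ((u : {u // u ∉ S}) → Fin (c.size u))) := by
    rw [← Finset.card_univ]
    refine Finset.card_le_card_of_injOn (fun w => (F w, fun u => w u)) (by simp) ?_
    intro w hw w' hw' h
    simp only [Prod.mk.injEq] at h
    refine hF w w' (by simpa using hw) (by simpa using hw') (fun u hu => ?_) h.1
    exact congrFun h.2 ⟨u, hu⟩
  rw [Fintype.card_prod, hκ, Fintype.card_pi] at h1
  have h2 := c.card_messages_le he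
  have h3 : Fintype.card c.Messages =
      (∏ u ∈ S, c.size u) * ∏ u : {u // u ∉ S}, Fintype.card (Fin (c.size u)) := by
    simp only [Fintype.card_pi, Fintype.card_fin]
    rw [← Finset.prod_mul_prod_compl S]
    congr 1
    exact (Finset.prod_subtype _ (fun u => by simp) _)
  have hpos : 0 < ∏ u : {u // u ∉ S}, Fintype.card (Fin (c.size u)) :=
    Finset.prod_pos fun u _ => by simpa using c.size_pos u
  have h4 : ∏ u ∈ S, c.size u ≤ 2 ^ (n + 1) := by
    refine Nat.le_of_mul_le_mul_right ?_ hpos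
    rw [← h3, pow_succ]
    refine h2.trans ((Nat.mul_le_mul_left 2 h1).trans_eq (by ring))
  rw [← Real.logb_prod _ _ fun u _ => by exact_mod_cast (c.size_pos u).ne']
  have h5 : Real.logb 2 (∏ u ∈ S, (c.size u : ℝ)) ≤ Real.logb 2 (2 ^ (n + 1)) := by
    refine Real.logb_le_logb_of_le one_lt_two ?_ (by exact_mod_cast h4)
    exact Finset.prod_pos fun u _ => by exact_mod_cast c.size_pos u
  rw [Real.logb_pow, Real.logb_self_eq_one one_lt_two, mul_one] at h5
  exact_mod_cast h5

/-- A sink is never among the sources, so its own message agrees in `w` and `w'`; equal receptions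
then force equal decisions, which are correct. -/
theorem eq_of_correct {w w' : c.Messages} (hw : c.Correct w) (hw' : c.Correct w')
    {I : Finset (Fin M)} {d : Fin M → Bool} (h : ∀ u ∉ sources I d, w u = w' u)
    (hr : ∀ u ∈ sources I d, ∀ s < c.T,
      c.received w s (some (partner u)) = c.received w' s (some (partner u))) : w = w' := by
  funext u
  by_cases hu : u ∈ sources I d
  · have hp : partner u ∉ sources I d := fun hp => by
      rw [mem_sources] at hu hp
      have := hu.2.trans hp.2.symm
      simp at this
    have h1 := c.decoded_congr (h _ hp) (hr u hu)
    rw [hw, hw'] at h1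
    -- The message types depend on the user, so `partner (partner u)` is generalized before being
    -- identified with `u`.
    have h2 : ∀ v, v = u → w v = w' v → w u = w' u := by rintro v rfl h; exact h
    exact h2 _ (partner_partner u) h1
  · exact h u hu

theorem card_slots_signal (A : Finset ℕ) (N : ℕ) :
    Fintype.card (A → Fin N → ZMod 2) = 2 ^ (N * A.card) := by
  rw [Fintype.card_fun, Fintype.card_fun, ZMod.card, Fintype.card_fin, Fintype.card_coe, pow_mul]

theorem card_filter_mode_ne (m₁ m₂ m : RelayMode) (h12 : m₁ ≠ m₂)
    (h : ∀ m', m' ≠ m ↔ m' = m₁ ∨ m' = m₂) :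
    ((Finset.range c.T).filter fun τ => c.mode τ ≠ m).card
      = c.modeCount m₁ + c.modeCount m₂ := by
  simp_rw [h, modeCount]
  rw [Finset.filter_or, Finset.card_union_of_disjoint]
  exact Finset.disjoint_filter.2 fun τ _ h1 h2 => h12 (h1.symm.trans h2)

theorem sum_logb_size_le_up (he : c.errorProb ≤ 1 / 2) (I : Finset (Fin M)) (d : Fin M → Bool) :
    ∑ i ∈ I, Real.logb 2 (c.size (i, d i)) ≤ (I.sup fun i => net.up (i, d i) : ℕ) *
      ((c.modeCount .duplex : ℝ) + c.modeCount .listen) + 1 := by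
  set N := I.sup fun i => net.up (i, d i)
  have hN : ∀ u ∈ sources I d, net.up u ≤ N := fun u hu => by
    obtain ⟨h1, h2⟩ := mem_sources.1 hu
    rw [show u = (u.1, d u.1) from Prod.ext rfl h2]
    exact Finset.le_sup (f := fun i => net.up (i, d i)) h1
  have h := c.sum_logb_size_le he (sources I d) _
    (card_slots_signal ((Finset.range c.T).filter fun τ => c.mode τ ≠ .transmit) N)
    (fun w τ => net.upSignal (sources I d) N (c.input w τ)) fun w w' hw hw' hww' hF =>
      c.eq_of_correct hw hw' hww' fun u _ s hs =>
        c.received_congr_of_upSignal hN hww' (fun τ hτ hm => congrFun hF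
          ⟨τ, Finset.mem_filter.2 ⟨Finset.mem_range.2 hτ, hm⟩⟩) s hs _
  rw [c.card_filter_mode_ne .duplex .listen .transmit (by simp)
    (by intro m; cases m <;> simp), sum_sources (R := fun u => Real.logb 2 (c.size u))] at h
  exact_mod_cast h

theorem sum_logb_size_le_down (he : c.errorProb ≤ 1 / 2) (I : Finset (Fin M))
    (d : Fin M → Bool) :
    ∑ i ∈ I, Real.logb 2 (c.size (i, d i)) ≤ (I.sup fun i => net.down (partner (i, d i)) : ℕ) *
      ((c.modeCount .duplex : ℝ) + c.modeCount .transmit) + 1 := by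
  set N := I.sup fun i => net.down (partner (i, d i))
  have hN : ∀ u ∈ sources I d, net.down (partner u) ≤ N := fun u hu => by
    obtain ⟨h1, h2⟩ := mem_sources.1 hu
    rw [show u = (u.1, d u.1) from Prod.ext rfl h2]
    exact Finset.le_sup (f := fun i => net.down (partner (i, d i))) h1
  have h := c.sum_logb_size_le he (sources I d) _
    (card_slots_signal ((Finset.range c.T).filter fun τ => c.mode τ ≠ .listen) N)
    (fun w τ => net.downSignal N (c.input w τ none)) fun w w' hw hw' hww' hF =>
      c.eq_of_correct hw hw' hww' fun u hu s hs =>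
        c.received_congr_of_downSignal (hN u hu) (fun τ hτ hm => congrFun hF
          ⟨τ, Finset.mem_filter.2 ⟨Finset.mem_range.2 hτ, hm⟩⟩) s hs
  rw [c.card_filter_mode_ne .duplex .transmit .listen (by simp)
    (by intro m; cases m <;> simp), sum_sources (R := fun u => Real.logb 2 (c.size u))] at h
  exact_mod_cast h

end Code

/-! ### The converse in the limit of long blocks -/

section Converse

variable {M : ℕ} (net : RelayNetwork M) {frac : RelayMode → ℝ}

theorem le_of_forall_code {R : User M → ℝ} (hR : R ∈ capacityRegion net frac)
    (m₁ m₂ : RelayMode) (I : Finset (Fin M)) (d : Fin M → Bool) (N : ℕ)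
    (h : ∀ c : Code net, c.errorProb ≤ 1 / 2 → ∑ i ∈ I, Real.logb 2 (c.size (i, d i)) ≤
      N * ((c.modeCount m₁ : ℝ) + c.modeCount m₂) + 1) :
    ∑ i ∈ I, R (i, d i) ≤ (frac m₁ + frac m₂) * N := by
  refine le_of_forall_pos_le_add fun δ hδ => ?_
  -- The losses, in units of `ε` per slot: one for each rate in `I`, `N` for rounding each of the
  -- two mode counts, and one for the additive bit. The last two kinds use `1 ≤ ε * T`.
  set K : ℝ := I.card + 2 * N + 1 with hK
  have hKpos : 0 < K := by positivity
  set ε : ℝ := min (1 / 2) (δ / K) with hε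
  have hεpos : 0 < ε := lt_min (by norm_num) (by positivity)
  obtain ⟨T₀, hT₀⟩ := exists_nat_gt (1 / ε)
  obtain ⟨c, hfr, hT, hrate, herr⟩ := hR.2 ε hεpos T₀
  have hTpos : (0 : ℝ) < c.T := by exact_mod_cast c.T_pos
  have hTε : 1 ≤ ε * c.T := by
    have : (T₀ : ℝ) ≤ c.T := by exact_mod_cast hT
    rw [div_lt_iff₀ hεpos] at hT₀
    nlinarith
  have h1 := h c (herr.trans (min_le_left _ _))
  have h2 : ∀ i ∈ I, (R (i, d i) - ε) * c.T ≤ Real.logb 2 (c.size (i, d i)) := fun i _ => by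
    have := hrate (i, d i)
    rwa [Code.rate, le_div_iff₀ hTpos] at this
  have h3 := Finset.sum_le_sum h2
  rw [← Finset.sum_mul, Finset.sum_sub_distrib, Finset.sum_const, nsmul_eq_mul] at h3
  have h4 := (abs_lt.1 (hfr m₁)).2
  have h5 := (abs_lt.1 (hfr m₂)).2
  have h6 : (c.modeCount m₁ : ℝ) + c.modeCount m₂ ≤ (frac m₁ + frac m₂ + 2 * ε) * c.T := by
    linarith
  have h7 := mul_le_mul_of_nonneg_left h6 (Nat.cast_nonneg (α := ℝ) N)
  have h8 : (∑ i ∈ I, R (i, d i)) * c.T ≤ ((frac m₁ + frac m₂) * N + K * ε) * c.T := by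
    rw [hK]
    nlinarith
  have h9 := le_of_mul_le_mul_right h8 hTpos
  have h10 : K * ε ≤ δ := by
    have := mul_le_mul_of_nonneg_left (min_le_right (1 / 2) (δ / K)) hKpos.le
    rwa [mul_div_cancel₀ _ hKpos.ne'] at this
  linarith

theorem capacityRegion_subset :
    capacityRegion net frac ⊆ gainRegion net (frac .duplex + frac .listen)
      (frac .duplex + frac .transmit) := fun _ hR =>
  ⟨hR.1, fun I d => le_min
    (le_of_forall_code net hR _ _ I d _ fun c he => c.sum_logb_size_le_up he I d)
    (le_of_forall_code net hR _ _ I d _ fun c he => c.sum_logb_size_le_down he I d)⟩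

theorem equationForwardingRegion_subset :
    equationForwardingRegion net frac ⊆ capacityRegion net frac := fun _ hR =>
  ⟨hR.1, fun ε hε T₀ => by
    obtain ⟨c, h1, h2, h3, h4, -⟩ := hR.2 ε hε T₀
    exact ⟨c, h1, h2, h3, h4.trans_le hε.le⟩⟩

end Converse

/-! ### Placing equations on levels by Hall's theorem -/

section Placement

variable {M : ℕ}

/-- When `r u` bits per user are exchanged, pair `i` needs one equation for each bit of the user
that has more of them; equation `k` involves the users with more than `k` bits. -/
abbrev Equation (r : User M → ℕ) := Σ i : Fin M, Fin (max (r (i, false)) (r (i, true)))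

/-- The equation of the `k`-th bit of user `u`. -/
def Equation.ofBit {r : User M → ℕ} (u : User M) (k : Fin (r u)) : Equation r :=
  ⟨u.1, Fin.castLE (by rcases u with ⟨i, _ | _⟩ <;> simp) k⟩

theorem Equation.ofBit_injective {r : User M → ℕ} (u : User M) :
    Function.Injective (Equation.ofBit (r := r) u) := fun k k' h => by
  simpa [Equation.ofBit] using h

/-- If the bounds of the gain region hold, then the equations can be put on the first `a` slots so
that each is below the bounds `g` of all users it involves. -/
theorem exists_placement (r g : User M → ℕ) (a N : ℕ) (hg : ∀ u, g u ≤ N)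
    (h : ∀ (I : Finset (Fin M)) (d : Fin M → Bool),
      ∑ i ∈ I, r (i, d i) ≤ a * I.sup fun i => g (i, d i)) :
    ∃ f : Equation r → Fin a × Fin N, Function.Injective f ∧
      ∀ u k, ((f (Equation.ofBit u k)).2 : ℕ) < g u := by
  classical
  -- `σ e` is the most restrictive user involved in `e`; respecting its bound respects all of them.
  have hσ : ∀ e : Equation r, ∃ s, (e.2 : ℕ) < r (e.1, s) ∧
      ∀ s', (e.2 : ℕ) < r (e.1, s') → g (e.1, s) ≤ g (e.1, s') := fun e => by
    have hne : (Finset.univ.filter fun s => (e.2 : ℕ) < r (e.1, s)).Nonempty := by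
      rcases lt_max_iff.1 e.2.isLt with h | h
      · exact ⟨false, by simpa using h⟩
      · exact ⟨true, by simpa using h⟩
    obtain ⟨s, hs, hmin⟩ := Finset.exists_min_image _ (fun s => g (e.1, s)) hne
    exact ⟨s, (Finset.mem_filter.1 hs).2, fun s' hs' => hmin s' (by simpa using hs')⟩
  choose σ hσ1 hσ2 using hσ
  obtain ⟨f, hf, hft⟩ := (Finset.all_card_le_biUnion_card_iff_exists_injective
    fun e : Equation r => (Finset.univ : Finset (Fin a)) ×ˢ
      Finset.univ.filter fun l : Fin N => (l : ℕ) < g (e.1, σ e)).1 fun E => by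
    rcases E.eq_empty_or_nonempty with rfl | hE
    · simp
    -- The allowed sets are nested, so the one of the least restricted equation is the whole union;
    -- it has `a * H` places.
    obtain ⟨e₀, he₀, hmax⟩ := Finset.exists_max_image E (fun e => g (e.1, σ e)) hE
    refine le_trans ?_ (Finset.card_le_card (Finset.subset_biUnion_of_mem _ he₀))
    set H := g (e₀.1, σ e₀)
    have hH : H ≤ N := hg _
    rw [Finset.card_product, Finset.card_univ, Fintype.card_fin, Fin.card_filter_val_lt,
      min_eq_right hH]
    -- Among the users of pair `i` with bound at most `H`, choose one with the most bits. If there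
    -- is none, the default `false` keeps `i` out of `I`.
    let d : Fin M → Bool := fun i =>
      decide (g (i, true) ≤ H ∧ (g (i, false) ≤ H → r (i, false) ≤ r (i, true)))
    have hd : ∀ i s, g (i, s) ≤ H → g (i, d i) ≤ H ∧ r (i, s) ≤ r (i, d i) := fun i s hs => by
      by_cases h1 : g (i, true) ≤ H ∧ (g (i, false) ≤ H → r (i, false) ≤ r (i, true))
      · have : d i = true := decide_eq_true h1
        rw [this]
        cases s
        · exact ⟨h1.1, h1.2 hs⟩
        · exact ⟨h1.1, le_rfl⟩
      · have : d i = false := decide_eq_false h1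
        rw [this]
        cases s
        · exact ⟨hs, le_rfl⟩
        · have h2 : ¬(g (i, false) ≤ H → r (i, false) ≤ r (i, true)) := fun h2 => h1 ⟨hs, h2⟩
          push Not at h2
          exact ⟨h2.1, h2.2.le⟩
    let I : Finset (Fin M) := Finset.univ.filter fun i => g (i, d i) ≤ H
    -- An equation of `E` involves a user with bound at most `H`, so its index is below the number
    -- of bits of the chosen user.
    calc E.card ≤ (I.sigma fun i => Finset.range (r (i, d i))).card := by
          refine Finset.card_le_card_of_injOn (fun e => ⟨e.1, e.2⟩) (fun e he => ?_) ?_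
          · obtain ⟨h1, h2⟩ := hd e.1 (σ e) (hmax e he)
            simp only [Finset.coe_sigma, Set.mem_sigma_iff, Finset.mem_coe, Finset.mem_range]
            exact ⟨Finset.mem_filter.2 ⟨Finset.mem_univ _, h1⟩, (hσ1 e).trans_le h2⟩
          · rintro ⟨i, k⟩ _ ⟨i', k'⟩ _ hee
            simp only [Sigma.mk.injEq] at hee
            obtain ⟨rfl, hk⟩ := hee
            simpa [Fin.ext_iff] using hk
      _ = ∑ i ∈ I, r (i, d i) := by simp
      _ ≤ a * I.sup fun i => g (i, d i) := h I d
      _ ≤ a * H := Nat.mul_le_mul_left _ (Finset.sup_le fun i hi => (Finset.mem_filter.1 hi).2)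
  refine ⟨f, hf, fun u k => ?_⟩
  have h1 := hft (Equation.ofBit u k)
  rw [Finset.mem_product, Finset.mem_filter] at h1
  exact h1.2.2.trans_le (hσ2 (Equation.ofBit u k) u.2 k.isLt)

end Placement

/-- A schedule for equation forwarding: every equation `e` is received by the relay in the slot
`(upPlace e).1`, on the level `(upPlace e).2` counted from below, and sent by it in the slot
`(downPlace e).1`, on the level `(downPlace e).2` counted from above. -/
structure Schedule {M : ℕ} (net : RelayNetwork M) (T Q : ℕ) (mode : ℕ → RelayMode)
    (b : User M → ℕ) (ι : Type) where
  T_pos : 0 < T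
  eqn : ∀ u, Fin (b u) → ι
  eqn_injective : ∀ u, Function.Injective (eqn u)
  pair_eq : ∀ u v j k, eqn u j = eqn v k → u.1 = v.1
  upPlace : ι → Fin T × Fin net.q
  upPlace_injective : Function.Injective upPlace
  downPlace : ι → Fin T × Fin net.q
  downPlace_injective : Function.Injective downPlace
  lt_up : ∀ u j, ((upPlace (eqn u j)).2 : ℕ) < net.up u
  lt_down : ∀ u j, ((downPlace (eqn u j)).2 : ℕ) < net.down (partner u)
  mode_up : ∀ e, mode (upPlace e).1 ≠ .transmit
  mode_down : ∀ e, mode (downPlace e).1 ≠ .listen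
  causal : ∀ e, (upPlace e).1 < (downPlace e).1
  period : ∀ e, (downPlace e).1.val / Q ≤ (upPlace e).1.val / Q + 1

/-! ### Zero-error codes from schedules -/

namespace Schedule

variable {M : ℕ} {net : RelayNetwork M} {T Q : ℕ} {mode : ℕ → RelayMode} {b : User M → ℕ}
  {ι : Type} (s : Schedule net T Q mode b ι)

/-- Messages as bit strings. -/
noncomputable def bits (n : ℕ) : Fin (2 ^ n) ≃ (Fin n → ZMod 2) :=
  (Fintype.equivFinOfCardEq (by rw [Fintype.card_fun, ZMod.card, Fintype.card_fin])).symm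

/-- Where user `u` sends its `j`-th bit. -/
def place (u : User M) (j : Fin (b u)) : Fin T × Fin net.q :=
  ((s.upPlace (s.eqn u j)).1,
    -- The shift by `q - up u` moves this level to the intended one, counted from below at the
    -- relay.
    ⟨net.up u - 1 - (s.upPlace (s.eqn u j)).2, by
      have := s.lt_up u j
      have := net.up_le_q u
      omega⟩)

open Classical in
/-- The received level that the relay forwards on a given level. -/
noncomputable def fwd (a : Fin T × Fin net.q) : Option (Fin T × Fin net.q) :=
  if h : ∃ e, s.downPlace e = a then
    some ((s.upPlace h.choose).1, (s.upPlace h.choose).2.rev) else none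

/-- Where user `u` reads the `j`-th bit of its partner. -/
def read (u : User M) (j : Fin (b (partner u))) : Fin T × Fin net.q :=
  ((s.downPlace (s.eqn (partner u) j)).1,
    ⟨(s.downPlace (s.eqn (partner u) j)).2 + (net.q - net.down u), by
      have h := s.lt_down (partner u) j
      rw [partner_partner] at h
      have := net.down_le_q u
      omega⟩)

open Classical in
/-- The bit of user `u` in the same equation as the `j`-th bit of its partner. -/
noncomputable def own (u : User M) (j : Fin (b (partner u))) : Option (Fin (b u)) :=
  if h : ∃ k, s.eqn u k = s.eqn (partner u) j then some h.choose else none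

theorem fwd_downPlace (e : ι) :
    s.fwd (s.downPlace e) = some ((s.upPlace e).1, (s.upPlace e).2.rev) := by
  have h : ∃ e', s.downPlace e' = s.downPlace e := ⟨e, rfl⟩
  rw [fwd, dif_pos h, s.downPlace_injective h.choose_spec]

theorem exists_of_fwd_eq_some {a a' : Fin T × Fin net.q} (h : s.fwd a = some a') :
    ∃ e, s.downPlace e = a ∧ a' = ((s.upPlace e).1, (s.upPlace e).2.rev) := by
  by_cases he : ∃ e, s.downPlace e = a
  · obtain ⟨e, rfl⟩ := he
    rw [fwd_downPlace, Option.some.injEq] at h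
    exact ⟨e, rfl, h.symm⟩
  · rw [fwd, dif_neg he] at h
    cases h

/-- The code that follows the schedule. -/
noncomputable def code : Code net where
  T := T
  T_pos := s.T_pos
  mode := mode
  size u := 2 ^ b u
  size_pos u := by positivity
  userEnc u w τ _ l :=
    ∑ j, if ((s.place u j).1 : ℕ) = τ ∧ (s.place u j).2 = l then bits (b u) w j else 0
  relayEnc τ y l :=
    if hτ : τ < T then
      (s.fwd (⟨τ, hτ⟩, l)).elim 0 fun e => if h : e.1.val < τ then y ⟨e.1.val, h⟩ e.2 else 0
    else 0
  dec u w y := (bits (b (partner u))).symm fun j =>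
    y (s.read u j).1 (s.read u j).2 + (s.own u j).elim 0 (bits (b u) w)

theorem userEnc_code (u : User M) (w : Fin (2 ^ b u)) (τ : ℕ) (y : Fin τ → net.Vec)
    (l : Fin net.q) : s.code.userEnc u w τ y l =
      ∑ j, if ((s.place u j).1 : ℕ) = τ ∧ (s.place u j).2 = l then bits (b u) w j else 0 := rfl

theorem place_injective (u : User M) : Function.Injective (s.place u) := fun j k h => by
  obtain ⟨h1, h2⟩ := Prod.ext_iff.1 h
  refine s.eqn_injective u (s.upPlace_injective (Prod.ext h1 (Fin.ext ?_)))
  have h3 := s.lt_up u j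
  have h4 := s.lt_up u k
  simp only [place, Fin.mk.injEq] at h2
  omega

/-- This turns a meeting of two bits at the relay into an equality of uplink places, hence of
equations. -/
theorem received_level_eq {u : User M} {j : Fin (b u)} {l : Fin net.q}
    (h : (shift net.q ^ (net.q - net.up u)) l (s.place u j).2 ≠ 0) :
    l = (s.upPlace (s.eqn u j)).2.rev := by
  rw [shift_pow_apply, ne_eq, ite_eq_right_iff, Classical.not_imp] at h
  have h1 := h.1
  have h2 := s.lt_up u j
  have h3 := net.up_le_q u
  simp only [place] at h1
  rw [Fin.ext_iff, Fin.val_rev]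
  omega

theorem isEquationForwarding : s.code.IsEquationForwarding Q := by
  refine ⟨b, fun u => bits (b u), s.place, s.fwd, s.read, s.own, s.place_injective, ?_, ?_, ?_, ?_,
    ?_, ?_⟩
  · intro u w (τ : Fin T) y l
    refine (s.userEnc_code u w τ y l).trans (Finset.sum_congr rfl fun j _ => ?_)
    have h : (((s.place u j).1 : ℕ) = τ ∧ (s.place u j).2 = l) ↔ s.place u j = (τ, l) :=
      ⟨fun h => Prod.ext (Fin.ext h.1) h.2, fun h => by rw [h]; exact ⟨rfl, rfl⟩⟩
    by_cases hj : s.place u j = (τ, l)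
    · exact (if_pos (h.2 hj)).trans (if_pos hj).symm
    · exact (if_neg (mt h.1 hj)).trans (if_neg hj).symm
  · intro u v j k l hslot hj hk
    refine s.pair_eq u v j k (s.upPlace_injective (Prod.ext hslot ?_))
    exact Fin.rev_injective ((s.received_level_eq hj).symm.trans (s.received_level_eq hk))
  · intro a a' e h h'
    obtain ⟨x, rfl, hx⟩ := s.exists_of_fwd_eq_some h
    obtain ⟨x', rfl, hx'⟩ := s.exists_of_fwd_eq_some h'
    obtain ⟨h1, h2⟩ := Prod.ext_iff.1 (hx.symm.trans hx')
    rw [s.upPlace_injective (Prod.ext h1 (Fin.rev_injective h2))]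
  · intro a e h
    obtain ⟨x, rfl, rfl⟩ := s.exists_of_fwd_eq_some h
    exact ⟨s.causal x, s.period x⟩
  · intro τ y l
    have hτ : τ.val < T := τ.isLt
    simp only [code, hτ, dite_true]
    change (s.fwd (τ, l)).elim _ _ = _
    cases s.fwd (τ, l) <;> rfl
  · intro u w y j
    exact congrFun (Equiv.apply_symm_apply _ _) j

/-- The relay receives each equation as the sum of its bits. -/
theorem received_upPlace (w : s.code.Messages) (e : ι) [DecidableEq ι] :
    s.code.received w (s.upPlace e).1 none (s.upPlace e).2.rev =
      ∑ v, ∑ j, if s.eqn v j = e then bits (b v) (w v) j else 0 := by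
  have hm : s.code.mode (s.upPlace e).1 ≠ .transmit := s.mode_up e
  rw [Code.received_eq, RelayNetwork.channel_relay _ hm, Finset.sum_apply]
  refine Finset.sum_congr rfl fun v _ => ?_
  rw [shift_pow_mulVec]
  have hq := net.up_le_q v
  have hrev := Fin.val_rev (s.upPlace e).2
  split_ifs with h
  · refine (s.userEnc_code v (w v) _ _ _).trans ?_
    refine Finset.sum_congr rfl fun j _ => ?_
    refine if_congr ?_ rfl rfl
    have hj := s.lt_up v j
    constructor
    · rintro ⟨h1, h2⟩
      refine s.upPlace_injective (Prod.ext (Fin.ext h1) (Fin.ext ?_))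
      simp only [place, Fin.mk.injEq] at h2
      omega
    · rintro rfl
      refine ⟨rfl, Fin.ext ?_⟩
      simp only [place]
      omega
  · refine (Finset.sum_eq_zero fun j _ => if_neg ?_).symm
    rintro rfl
    have hj := s.lt_up v j
    omega

/-- The downlink shift by `q - down u` is undone by `read`, and causality ensures that the relay
already holds the equation it forwards. -/
theorem received_downPlace (w : s.code.Messages) (u : User M) (j : Fin (b (partner u))) :
    s.code.received w (s.read u j).1 (some u) (s.read u j).2 =
      s.code.received w (s.upPlace (s.eqn (partner u) j)).1 none
        (s.upPlace (s.eqn (partner u) j)).2.rev := by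
  set e := s.eqn (partner u) j with he
  have hc : (s.upPlace e).1.val < (s.downPlace e).1.val := s.causal e
  have hm : s.code.mode (s.read u j).1 ≠ .listen := s.mode_down e
  rw [Code.received_eq _ _ (s.read u j).1, RelayNetwork.channel_user _ hm,
    shift_pow_mulVec, if_pos (by simp [read])]
  have hl : (⟨(s.read u j).2 - (net.q - net.down u),
      (Nat.sub_le _ _).trans_lt (s.read u j).2.isLt⟩ : Fin net.q) = (s.downPlace e).2 :=
    Fin.ext (by simp [read, he])
  rw [hl]
  change (if hτ : (s.downPlace e).1.val < T then
      (s.fwd (⟨(s.downPlace e).1.val, hτ⟩, (s.downPlace e).2)).elim (0 : ZMod 2) _ else 0) = _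
  rw [dif_pos (s.downPlace e).1.isLt]
  change (s.fwd (s.downPlace e)).elim (0 : ZMod 2) _ = _
  rw [fwd_downPlace]
  change (if h : (s.upPlace e).1.val < (s.downPlace e).1.val then _ else _) = _
  rw [dif_pos hc]

/-- The equation contains the wanted bit and at most one bit of `u`. Adding the latter again cancels
it in characteristic two. -/
theorem decoded_eq (w : s.code.Messages) (u : User M) : s.code.decoded w u = w (partner u) := by
  classical
  refine (bits (b (partner u))).injective (funext fun j => ?_)
  change bits (b (partner u)) ((bits (b (partner u))).symm _) j = _
  rw [Equiv.apply_symm_apply]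
  change s.code.received w (s.read u j).1 (some u) (s.read u j).2 + _ = _
  rw [received_downPlace, received_upPlace, Finset.sum_eq_add_of_mem (partner u) u
    (Finset.mem_univ _) (Finset.mem_univ _) (by simp [partner, Prod.ext_iff])]
  · have h1 : (∑ k, if s.eqn (partner u) k = s.eqn (partner u) j
        then bits (b (partner u)) (w (partner u)) k else 0)
        = bits (b (partner u)) (w (partner u)) j := by
      simp [(s.eqn_injective (partner u)).eq_iff]
    have h2 : (∑ k, if s.eqn u k = s.eqn (partner u) j then bits (b u) (w u) k else 0)
        = (s.own u j).elim 0 (bits (b u) (w u)) := by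
      by_cases h : ∃ k, s.eqn u k = s.eqn (partner u) j
      · rw [own, dif_pos h]
        conv_lhs => rw [← h.choose_spec]
        simp [(s.eqn_injective u).eq_iff]
      · rw [own, dif_neg h]
        exact Finset.sum_eq_zero fun k _ => if_neg fun hk => h ⟨k, hk⟩
    rw [h1, h2, add_assoc, CharTwo.add_self_eq_zero, add_zero]
  · rintro v _ ⟨hv1, hv2⟩
    refine Finset.sum_eq_zero fun k _ => if_neg fun hk => ?_
    have h := s.pair_eq _ _ _ _ hk
    obtain ⟨i, a⟩ := v
    obtain ⟨i', a'⟩ := u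
    simp only [partner] at h hv1 hv2
    subst h
    cases a <;> cases a' <;> simp_all

theorem errorProb_eq_zero : s.code.errorProb = 0 := by
  rw [Code.errorProb]
  simp [decoded_eq]

end Schedule

/-! ### Achievability for both relay types -/

section Achievability

variable {M : ℕ} (net : RelayNetwork M)

/-- With a full-duplex relay, the equations of a period are forwarded in the next period. -/
theorem exists_fullDuplex_code (Q B : ℕ) (hQ : 0 < Q) (r : User M → ℕ)
    (hup : ∀ (I : Finset (Fin M)) (d : Fin M → Bool),
      ∑ i ∈ I, r (i, d i) ≤ Q * I.sup fun i => net.up (i, d i))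
    (hdown : ∀ (I : Finset (Fin M)) (d : Fin M → Bool),
      ∑ i ∈ I, r (i, d i) ≤ Q * I.sup fun i => net.down (partner (i, d i))) :
    ∃ c : Code net, c.HasFractions fullDuplex ∧ c.T = (B + 1) * Q ∧
      (∀ u, c.size u = 2 ^ (B * r u)) ∧ c.errorProb = 0 ∧ c.IsEquationForwarding Q := by
  obtain ⟨f, hf, hfu⟩ := exists_placement r net.up Q net.q net.up_le_q hup
  obtain ⟨g, hg, hgu⟩ := exists_placement r (fun u => net.down (partner u)) Q net.q
    (fun u => net.down_le_q _) hdown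
  have hlt : ∀ (k : ℕ) (_ : k < B + 1) (a : Fin Q), k * Q + a < (B + 1) * Q := fun k hk a => by
    have := Nat.mul_le_mul_right Q (Nat.succ_le_of_lt hk)
    rw [Nat.succ_mul] at this
    have := a.isLt
    omega
  have hdiv : ∀ (k : ℕ) (a : Fin Q), (k * Q + a) / Q = k := fun k a => by
    rw [Nat.add_comm, Nat.add_mul_div_right _ _ hQ, Nat.div_eq_of_lt a.isLt, zero_add]
  have hinj : ∀ (k k' : ℕ) (a a' : Fin Q), k * Q + a = k' * Q + a' → k = k' ∧ a = a' :=
    fun k k' a a' h => by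
      have hk : k = k' := by rw [← hdiv k a, h, hdiv]
      subst hk
      exact ⟨rfl, Fin.ext (by omega)⟩
  let s : Schedule net ((B + 1) * Q) Q (fun _ => .duplex) (fun u => B * r u)
      (Fin B × Equation r) :=
    { T_pos := by positivity
      eqn := fun u j => ((finProdFinEquiv.symm j).1, Equation.ofBit u (finProdFinEquiv.symm j).2)
      eqn_injective := fun u j k h => by
        obtain ⟨h1, h2⟩ := Prod.ext_iff.1 h
        exact finProdFinEquiv.symm.injective (Prod.ext h1 (Equation.ofBit_injective u h2))
      pair_eq := fun u v j k h => congrArg (fun e : Fin B × Equation r => e.2.1) h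
      upPlace := fun e => (⟨e.1 * Q + (f e.2).1, hlt _ (by omega) _⟩, (f e.2).2)
      upPlace_injective := fun e e' h => by
        obtain ⟨h1, h2⟩ := Prod.ext_iff.1 h
        obtain ⟨h3, h4⟩ := hinj _ _ _ _ (Fin.ext_iff.1 h1)
        exact Prod.ext (Fin.ext h3) (hf (Prod.ext h4 h2))
      -- One period of delay makes every placement within a period causal, and explains the extra
      -- period after the `B` batches.
      downPlace := fun e => (⟨(e.1 + 1) * Q + (g e.2).1, hlt _ (by omega) _⟩, (g e.2).2)
      downPlace_injective := fun e e' h => by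
        obtain ⟨h1, h2⟩ := Prod.ext_iff.1 h
        obtain ⟨h3, h4⟩ := hinj _ _ _ _ (Fin.ext_iff.1 h1)
        exact Prod.ext (Fin.ext (Nat.succ_injective h3)) (hg (Prod.ext h4 h2))
      lt_up := fun u j => hfu u _
      lt_down := fun u j => hgu u _
      mode_up := fun _ => by simp
      mode_down := fun _ => by simp
      causal := fun e => by
        rw [Fin.lt_def]
        have := (f e.2).1.isLt
        simp only [add_mul, one_mul]
        omega
      period := fun e => by simp only [hdiv, le_refl] }
  refine ⟨s.code, ?_, rfl, fun u => rfl, s.errorProb_eq_zero, s.isEquationForwarding⟩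
  have h1 : ∀ m, s.code.modeCount m = if m = .duplex then (B + 1) * Q else 0 := fun m => by
    change ((Finset.range ((B + 1) * Q)).filter fun _ => RelayMode.duplex = m).card = _
    by_cases hm : m = .duplex
    · simp [hm]
    · simp [hm, Ne.symm hm]
  intro m
  rw [h1]
  change |_ - _ * (((B + 1) * Q : ℕ) : ℝ)| < 1
  cases m <;> simp [fullDuplex]

/-- With a half-duplex relay, the equations are received in the first `l` slots and forwarded in
the others. -/
theorem exists_halfDuplex_code (Q l : ℕ) (hQ : 0 < Q) (hl : l ≤ Q) (r : User M → ℕ)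
    (hup : ∀ (I : Finset (Fin M)) (d : Fin M → Bool),
      ∑ i ∈ I, r (i, d i) ≤ l * I.sup fun i => net.up (i, d i))
    (hdown : ∀ (I : Finset (Fin M)) (d : Fin M → Bool),
      ∑ i ∈ I, r (i, d i) ≤ (Q - l) * I.sup fun i => net.down (partner (i, d i)))
    {t : ℝ} (ht : |(l : ℝ) - t * Q| < 1) :
    ∃ c : Code net, c.HasFractions (halfDuplex t) ∧ c.T = Q ∧ c.modeCount .listen = l ∧
      (∀ u, c.size u = 2 ^ r u) ∧ c.errorProb = 0 ∧ c.IsEquationForwarding Q := by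
  obtain ⟨f, hf, hfu⟩ := exists_placement r net.up l net.q net.up_le_q hup
  obtain ⟨g, hg, hgu⟩ := exists_placement r (fun u => net.down (partner u)) (Q - l) net.q
    (fun u => net.down_le_q _) hdown
  let s : Schedule net Q Q (fun τ => if τ < l then .listen else .transmit) r (Equation r) :=
    { T_pos := hQ
      eqn := Equation.ofBit
      eqn_injective := Equation.ofBit_injective
      pair_eq := fun u v j k h => congrArg Sigma.fst h
      upPlace := fun e => (Fin.castLE hl (f e).1, (f e).2)
      upPlace_injective := fun e e' h => by
        obtain ⟨h1, h2⟩ := Prod.ext_iff.1 h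
        exact hf (Prod.ext (Fin.castLE_injective hl h1) h2)
      downPlace := fun e => (⟨l + (g e).1, by omega⟩, (g e).2)
      downPlace_injective := fun e e' h => by
        obtain ⟨h1, h2⟩ := Prod.ext_iff.1 h
        have h3 := Fin.ext_iff.1 h1
        exact hg (Prod.ext (Fin.ext (Nat.add_left_cancel h3)) h2)
      lt_up := fun u j => hfu u _
      lt_down := fun u j => hgu u _
      mode_up := fun e => by simp
      mode_down := fun e => by simp
      causal := fun e => by
        rw [Fin.lt_def]
        simp only [Fin.val_castLE]
        omega
      period := fun e => by
        rw [Nat.div_eq_of_lt (Fin.isLt _)]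
        exact Nat.zero_le _ }
  have h1 : s.code.modeCount .listen = l := by
    change ((Finset.range Q).filter fun τ =>
      (if τ < l then RelayMode.listen else .transmit) = .listen).card = l
    rw [show ((Finset.range Q).filter fun τ =>
      (if τ < l then RelayMode.listen else .transmit) = .listen) = Finset.range l by
        ext τ
        by_cases hτ : τ < l
        · simp [hτ, hτ.trans_le hl]
        · simp [hτ], Finset.card_range]
  have h2 : s.code.modeCount .transmit = Q - l := by
    change ((Finset.range Q).filter fun τ =>
      (if τ < l then RelayMode.listen else .transmit) = .transmit).card = Q - l
    rw [show ((Finset.range Q).filter fun τ =>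
      (if τ < l then RelayMode.listen else .transmit) = .transmit) = Finset.Ico l Q by
        ext τ
        simp [and_comm], Nat.card_Ico]
  have h3 : s.code.modeCount .duplex = 0 := by
    refine Finset.card_eq_zero.2 (Finset.filter_eq_empty_iff.2 fun τ _ => ?_)
    change ¬(if τ < l then RelayMode.listen else .transmit) = .duplex
    split_ifs <;> simp
  refine ⟨s.code, ?_, rfl, h1, fun u => rfl, s.errorProb_eq_zero, s.isEquationForwarding⟩
  intro m
  change |_ - _ * (Q : ℝ)| < 1
  cases m with
  | duplex => simp [h3, halfDuplex]
  | listen => rw [h1]; exact ht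
  | transmit =>
    rw [h2, Nat.cast_sub hl]
    change |_ - (1 - t) * (Q : ℝ)| < 1
    rw [show (Q : ℝ) - l - (1 - t) * Q = -(l - t * Q) by ring, abs_neg]
    exact ht

theorem rate_eq {c : Code net} {u : User M} {k : ℕ} (h : c.size u = 2 ^ k) :
    c.rate u = k / c.T := by
  rw [Code.rate, h, Nat.cast_pow, Nat.cast_two, Real.logb_pow, Real.logb_self_eq_one one_lt_two,
    mul_one]

/-- The integer bounds needed by the scheduler, for rates scaled up by `x` and rounded down. -/
theorem sum_floor_le {R : User M → ℝ} (hR : ∀ u, 0 ≤ R u) {x a : ℝ} (hx : 0 ≤ x) {n N : ℕ}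
    {I : Finset (Fin M)} {d : Fin M → Bool} (h : ∑ i ∈ I, R (i, d i) ≤ a * N)
    (hn : x * a ≤ n) : ∑ i ∈ I, ⌊x * R (i, d i)⌋₊ ≤ n * N := by
  have h1 : ∑ i ∈ I, (⌊x * R (i, d i)⌋₊ : ℝ) ≤ n * N := calc
    _ ≤ ∑ i ∈ I, x * R (i, d i) :=
        Finset.sum_le_sum fun i _ => Nat.floor_le (mul_nonneg hx (hR _))
    _ = x * ∑ i ∈ I, R (i, d i) := by rw [Finset.mul_sum]
    _ ≤ x * (a * N) := mul_le_mul_of_nonneg_left h hx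
    _ = x * a * N := by ring
    _ ≤ n * N := mul_le_mul_of_nonneg_right hn (Nat.cast_nonneg _)
  exact_mod_cast h1

theorem sum_le_of_div {r : User M → ℕ} {Q : ℕ} (hQ : 0 < Q) {a : ℝ} {n N : ℕ}
    {I : Finset (Fin M)} {d : Fin M → Bool} (h : ∑ i ∈ I, (r (i, d i) : ℝ) / Q ≤ a * N)
    (hn : (n : ℝ) = Q * a) : ∑ i ∈ I, r (i, d i) ≤ n * N := by
  rw [← Finset.sum_div, div_le_iff₀ (by exact_mod_cast hQ)] at h
  have h1 : ∑ i ∈ I, (r (i, d i) : ℝ) ≤ n * N := by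
    rw [hn]
    linarith
  exact_mod_cast h1

theorem gainRegion_subset_equationForwardingRegion_fullDuplex :
    gainRegion net 1 1 ⊆ equationForwardingRegion net fullDuplex := by
  rintro R ⟨hR, hgain⟩
  refine ⟨hR, fun ε hε T₀ => ?_⟩
  -- With period `n` and `n` batches the rate is `⌊n * R u⌋₊ / (n + 1)`, short of `R u` by at most
  -- `(R u + 1) / (n + 1)`. The sum over users dominates each numerator.
  obtain ⟨n, hn⟩ := exists_nat_gt (max (T₀ : ℝ) ((∑ u, (R u + 1)) / ε))
  have hnT : T₀ < n := by exact_mod_cast (le_max_left _ _).trans_lt hn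
  have hnε : ∑ u, (R u + 1) < n * ε := (div_lt_iff₀ hε).1 ((le_max_right _ _).trans_lt hn)
  have hnpos : 0 < n := by omega
  obtain ⟨c, h1, h2, h3, h4, h5⟩ := exists_fullDuplex_code net n n hnpos
    (fun u => ⌊(n : ℝ) * R u⌋₊)
    (fun I d => sum_floor_le hR (Nat.cast_nonneg _) (le_min_iff.1 (hgain I d)).1 (by simp))
    (fun I d => sum_floor_le hR (Nat.cast_nonneg _) (le_min_iff.1 (hgain I d)).2 (by simp))
  refine ⟨c, h1, ?_, fun u => ?_, h4, n, hnpos, h5⟩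
  · rw [h2]
    nlinarith
  · have hn0 : (0 : ℝ) < n := by exact_mod_cast hnpos
    have h6 : R u + 1 ≤ ∑ u, (R u + 1) :=
      Finset.single_le_sum (fun v _ => add_nonneg (hR v) zero_le_one) (Finset.mem_univ u)
    have h7 := Nat.lt_floor_add_one ((n : ℝ) * R u)
    rw [rate_eq net (h3 u), h2]
    push_cast
    rw [mul_comm ((n : ℝ) + 1), mul_div_mul_left _ _ hn0.ne', le_div_iff₀ (by positivity)]
    nlinarith

theorem gainRegion_subset_equationForwardingRegion_halfDuplex {t : ℝ} (ht0 : 0 ≤ t)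
    (ht1 : t ≤ 1) :
    gainRegion net t (1 - t) ⊆ equationForwardingRegion net (halfDuplex t) := by
  rintro R ⟨hR, hgain⟩
  refine ⟨hR, fun ε hε T₀ => ?_⟩
  -- Rounding `t * n` down may lose almost one listen slot. Scaling the rates by `n - K` instead of
  -- `n` makes up for it, since then `(n - K) * t ≤ t * n - 1` unless `t = 0`. The price is a rate
  -- loss of at most `(K * R u + 1) / n`.
  obtain ⟨K, hK⟩ : ∃ K : ℕ, t = 0 ∨ 1 ≤ K * t := by
    rcases ht0.eq_or_lt with h | h
    · exact ⟨0, Or.inl h.symm⟩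
    · obtain ⟨K, hK⟩ := exists_nat_gt (1 / t)
      exact ⟨K, Or.inr ((div_lt_iff₀ h).1 hK).le⟩
  obtain ⟨n, hn⟩ := exists_nat_gt (max (max (T₀ : ℝ) K) ((∑ u, (K * R u + 1)) / ε))
  have hnT : T₀ < n := by
    exact_mod_cast ((le_max_left _ _).trans (le_max_left _ _)).trans_lt hn
  have hnK : (K : ℝ) < n := ((le_max_right _ _).trans (le_max_left _ _)).trans_lt hn
  have hnε : ∑ u, (K * R u + 1) < n * ε := (div_lt_iff₀ hε).1 ((le_max_right _ _).trans_lt hn)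
  have hnpos : 0 < n := by omega
  have hn0 : (0 : ℝ) < n := by exact_mod_cast hnpos
  have htn : 0 ≤ t * n := by positivity
  have hf1 := Nat.floor_le htn
  have hf2 := Nat.lt_floor_add_one (t * n)
  have hln : ⌊t * n⌋₊ ≤ n := by
    have : (⌊t * n⌋₊ : ℝ) ≤ n := hf1.trans (by nlinarith)
    exact_mod_cast this
  have hK0 : (0 : ℝ) ≤ K := Nat.cast_nonneg _
  obtain ⟨c, h1, h2, -, h3, h4, h5⟩ := exists_halfDuplex_code net n ⌊t * n⌋₊ hnpos hln
    (fun u => ⌊((n : ℝ) - K) * R u⌋₊)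
    (fun I d => sum_floor_le hR (by linarith) (le_min_iff.1 (hgain I d)).1 (by
      rcases hK with h | h
      · simp [h]
      · linarith))
    (fun I d => sum_floor_le hR (by linarith) (le_min_iff.1 (hgain I d)).2 (by
      rw [Nat.cast_sub hln]
      nlinarith)) (t := t) (by rw [abs_lt]; constructor <;> linarith)
  refine ⟨c, h1, by omega, fun u => ?_, h4, n, hnpos, h5⟩
  have h6 : K * R u + 1 ≤ ∑ u, (K * R u + 1) :=
    Finset.single_le_sum (fun v _ => add_nonneg (mul_nonneg hK0 (hR v)) zero_le_one)
      (Finset.mem_univ u)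
  have h7 := Nat.lt_floor_add_one (((n : ℝ) - K) * R u)
  rw [rate_eq net (h3 u), h2, le_div_iff₀ hn0]
  nlinarith

end Achievability

/-- Equation forwarding lies in the capacity region, which lies in the gain region; achievability
closes the circle of inclusions. -/
theorem regions_eq {M : ℕ} (net : RelayNetwork M) {frac : RelayMode → ℝ} {a b : ℝ}
    (hfrac : ∀ m, 0 ≤ frac m) (ha : frac .duplex + frac .listen = a)
    (hb : frac .duplex + frac .transmit = b)
    (h : gainRegion net a b ⊆ equationForwardingRegion net frac) :
    capacityRegion net frac = cutSetRegion net frac ∧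
      equationForwardingRegion net frac = cutSetRegion net frac ∧
      cutSetRegion net frac = gainRegion net a b := by
  subst ha hb
  have h1 := cutSetRegion_eq_gainRegion net hfrac
  have h2 := capacityRegion_subset net (frac := frac)
  have h3 := equationForwardingRegion_subset net (frac := frac)
  exact ⟨h1 ▸ h2.antisymm (h.trans h3), h1 ▸ (h3.trans h2).antisymm h, h1⟩

end BiRelay

theorem theorem1 {M : ℕ} (net : BiRelay.RelayNetwork M) :
    -- full-duplex relay
    (BiRelay.capacityRegion net BiRelay.fullDuplex = BiRelay.cutSetRegion net BiRelay.fullDuplex ∧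
      BiRelay.equationForwardingRegion net BiRelay.fullDuplex =
        BiRelay.cutSetRegion net BiRelay.fullDuplex ∧
      BiRelay.cutSetRegion net BiRelay.fullDuplex = BiRelay.gainRegion net 1 1 ∧
      -- rational points, by `Q`-fold repetition (integer points: `Q = 1`)
      ∀ (Q : ℕ) (r : BiRelay.User M → ℕ), 0 < Q →
        (fun u => (r u : ℝ) / Q) ∈ BiRelay.cutSetRegion net BiRelay.fullDuplex →
        ∀ B : ℕ, ∃ c : BiRelay.Code net, c.HasFractions BiRelay.fullDuplex ∧
          c.T = (B + 1) * Q ∧ (∀ u, c.size u = 2 ^ (B * r u)) ∧ c.errorProb = 0 ∧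
          c.IsEquationForwarding Q) ∧
    -- half-duplex relay with a fixed listen fraction `t`
    ∀ t : ℝ, 0 ≤ t → t ≤ 1 →
      BiRelay.capacityRegion net (BiRelay.halfDuplex t) =
        BiRelay.cutSetRegion net (BiRelay.halfDuplex t) ∧
      BiRelay.equationForwardingRegion net (BiRelay.halfDuplex t) =
        BiRelay.cutSetRegion net (BiRelay.halfDuplex t) ∧
      BiRelay.cutSetRegion net (BiRelay.halfDuplex t) = BiRelay.gainRegion net t (1 - t) ∧
      -- `Q` slots, of which `Q t` are listen slots and the others transmit slots
      ∀ (Q s : ℕ) (r : BiRelay.User M → ℕ), 0 < Q → (s : ℝ) = Q * t →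
        (fun u => (r u : ℝ) / Q) ∈ BiRelay.cutSetRegion net (BiRelay.halfDuplex t) →
        ∃ c : BiRelay.Code net, c.HasFractions (BiRelay.halfDuplex t) ∧
          c.T = Q ∧ c.modeCount BiRelay.RelayMode.listen = s ∧
          (∀ u, c.size u = 2 ^ r u) ∧ c.errorProb = 0 ∧ c.IsEquationForwarding Q := by
  constructor
  · obtain ⟨h1, h2, h3⟩ := BiRelay.regions_eq net (frac := BiRelay.fullDuplex) (a := 1) (b := 1)
      (fun m => by cases m <;> simp [BiRelay.fullDuplex]) (by simp [BiRelay.fullDuplex])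
      (by simp [BiRelay.fullDuplex])
      (BiRelay.gainRegion_subset_equationForwardingRegion_fullDuplex net)
    refine ⟨h1, h2, h3, fun Q r hQ hr B => ?_⟩
    rw [h3] at hr
    exact BiRelay.exists_fullDuplex_code net Q B hQ r
      (fun I d => BiRelay.sum_le_of_div hQ (le_min_iff.1 (hr.2 I d)).1 (by ring))
      (fun I d => BiRelay.sum_le_of_div hQ (le_min_iff.1 (hr.2 I d)).2 (by ring))
  · intro t ht0 ht1
    obtain ⟨h1, h2, h3⟩ := BiRelay.regions_eq net (frac := BiRelay.halfDuplex t) (a := t)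
      (b := 1 - t) (fun m => by cases m <;> simp [BiRelay.halfDuplex, ht0, ht1])
      (by simp [BiRelay.halfDuplex]) (by simp [BiRelay.halfDuplex])
      (BiRelay.gainRegion_subset_equationForwardingRegion_halfDuplex net ht0 ht1)
    refine ⟨h1, h2, h3, fun Q s r hQ hs hr => ?_⟩
    rw [h3] at hr
    have hsQ : s ≤ Q := by
      have : (s : ℝ) ≤ Q := hs.trans_le (mul_le_of_le_one_right (Nat.cast_nonneg _) ht1)
      exact_mod_cast this
    exact BiRelay.exists_halfDuplex_code net Q s hQ hsQ r
      (fun I d => BiRelay.sum_le_of_div hQ (le_min_iff.1 (hr.2 I d)).1 hs)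
      (fun I d => BiRelay.sum_le_of_div hQ (le_min_iff.1 (hr.2 I d)).2
        (by rw [Nat.cast_sub hsQ, hs]; ring))
      (by rw [hs, mul_comm t, sub_self, abs_zero]; exact one_pos)
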